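/- A local field is a field $K$ that is complete with respect to a normalized discrete valuation $v_K\colon K^*\twoheadrightarrow\mathbb{Z}$ (no condition on the residue field). Let $L/K$ be a totally ramified finite abelian extension of local fields whose degree is a power of the residue characteristic $p>0$. Let $e_{L/K}=[L:K]$ be the ramification index and $d_{L/K}$ the valuation of the different of $L/K$. An element $x\in L$ is normal over $K$ if its conjugates under $\mathrm{Gal}(L/K)$ form a $K$-basis of $L$, and the valuation criterion $\mathrm{VC}(L/K)$ is the statement: every $x\in L^*$ with $v_L(x)\equiv -d_{L/K}-1 \pmod{e_{L/K}}$ is normal over $K$. A finite abelian extension $F/E$ of local fields, with Galois group of exponent $n$, is a unit root Kummer extension if $E$ contains a primitive $n$-th root of unity and $v_E(W)\subset n\mathbb{Z}$, where $W=(F^*)^n\cap E^*$. Let $m$ be the exponent of $\mathrm{Gal}(L/K)$, and let $r\mid m$ be the number of $m$-th roots of unity in $K$. If $p=2$ and $8\mid m$, assume that $r\neq 2$. Then $\mathrm{VC}(L/K)$ holds if and only if for all fields $K\subset E\subset F\subset L$ with $F/E$ cyclic of degree $r$, the extension $F/E$ is a unit root Kummer extension. In particular, if $K$ contains no primitive $p$-th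 root of unity, then $\mathrm{VC}(L/K)$ holds for every totally ramified abelian extension $L/K$ of $p$-power degree. -/

import Mathlib

open scoped WithZero

/-- The value group of a `ℤ`-valued valuation `u` on a field, written additively: the subgroup
`{log (u x) : x ≠ 0}` of `ℤ`. -/
def valueSubgroup {E : Type*} [Field E] (u : Valuation E ℤᵐ⁰) : AddSubgroup ℤ where
  carrier := {n | ∃ x : E, u x = WithZero.exp n}
  zero_mem' := ⟨1, by simp⟩
  add_mem' := by
    rintro a b ⟨x, hx⟩ ⟨y, hy⟩
    exact ⟨x * y, by rw [map_mul, hx, hy, WithZero.exp_add]⟩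
  neg_mem' := by
    rintro a ⟨x, hx⟩
    exact ⟨x⁻¹, by rw [map_inv₀, hx, WithZero.exp_neg]⟩

/-- The normalized additive valuation (with value group exactly `ℤ`) attached to a non-trivial
`ℤᵐ⁰`-valued valuation `u` on a field: one divides `-log (u x)` by the positive generator of the
value group of `u`. The division is exact, and `u` surjective gives `-log (u x)` itself. It is only
used at `x ≠ 0`. -/
noncomputable def normOrd {E : Type*} [Field E] (u : Valuation E ℤᵐ⁰) (x : E) : ℤ :=
  -WithZero.log (u x) / ((valueSubgroup u).index : ℤ)

/-- The ramification index `e_{L/K}`: the index of the value group of `K` in that of `L`, for a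
valuation `w` of `L`. For the normalized valuation `v_L` this says `v_L(K^*) = e_{L/K} ℤ`. -/
noncomputable def ramificationIndex (K : Type*) {L : Type*} [Field K] [Field L] [Algebra K L]
    (w : Valuation L ℤᵐ⁰) : ℕ :=
  (valueSubgroup (w.comap (algebraMap K L))).relIndex (valueSubgroup w)

/-- `L/K` is totally ramified: `e_{L/K} = [L : K]`. -/
def IsTotallyRamified (K : Type*) {L : Type*} [Field K] [Field L] [Algebra K L]
    (w : Valuation L ℤᵐ⁰) : Prop :=
  ramificationIndex K w = Module.finrank K L

/-- `d_{L/K}`: the valuation of the different of `L/K`. The inverse different is the largest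
fractional ideal `𝔭_L^i` of `L` whose trace lies in the valuation ring of `K`, and it equals
`𝔭_L^{-d}`; so `-d_{L/K}` is the least `i` with `Tr_{L/K}(𝔭_L^i) ⊆ 𝒪_K`. (For a finite separable
extension of local fields this set of `i` is non-empty and bounded below.) -/
noncomputable def differentValuation {K L : Type*} [Field K] [Field L] [Algebra K L]
    (v : Valuation K ℤᵐ⁰) (w : Valuation L ℤᵐ⁰) : ℤ :=
  -sInf {i : ℤ | ∀ x : L, x ≠ 0 → i ≤ normOrd w x → v (Algebra.trace K L x) ≤ 1}

/-- `x` is a normal basis generator of `L/K`: its conjugates form a `K`-basis of `L`. -/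
def IsNormalElement (K : Type*) {L : Type*} [Field K] [Field L] [Algebra K L] (x : L) : Prop :=
  LinearIndependent K (fun σ : Gal(L/K) => σ x) ∧
    Submodule.span K (Set.range fun σ : Gal(L/K) => σ x) = ⊤

/-- The valuation criterion `VC(L/K)`: all `x ∈ L^*` with
`v_L(x) ≡ -d_{L/K} - 1 mod e_{L/K}` are normal over `K`. -/
def ValuationCriterion {K L : Type*} [Field K] [Field L] [Algebra K L]
    (v : Valuation K ℤᵐ⁰) (w : Valuation L ℤᵐ⁰) : Prop :=
  ∀ x : L, x ≠ 0 →
    normOrd w x ≡ -differentValuation v w - 1 [ZMOD (ramificationIndex K w : ℤ)] →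
    IsNormalElement K x

/-- `F/E` is a unit root Kummer extension, where `u` is a valuation of `E`: it is finite abelian of
some exponent `m` such that `E` contains a primitive `m`-th root of unity, and
`v_E(W) ⊆ mℤ` for `W = (F^*)^m ∩ E^*`. -/
def IsUnitRootKummer {E : Type*} [Field E] (u : Valuation E ℤᵐ⁰)
    (F : Type*) [Field F] [Algebra E F] : Prop :=
  FiniteDimensional E F ∧ IsAbelianGalois E F ∧
    ∃ m : ℕ, (∃ ζ : E, IsPrimitiveRoot ζ m) ∧ Monoid.exponent Gal(F/E) = m ∧
      ∀ a : E, a ≠ 0 → (∃ y : F, y ^ m = algebraMap E F a) → (m : ℤ) ∣ normOrd u a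

/-! Write `n = [L:K]`, `G = Gal(L/K)` and `δ = -d - 1`. Every `z` with order congruent to `δ` mod
`n` has non-zero trace: traces are integral from order `-d` on, fail to be integral at order `-d -
1`, and scalars of `K` shift orders by multiples of `n`. Trace duality then turns the criterion into
a statement (*): every non-zero `G`-stable subspace `M` contains an element of order divisible by
`n`. If (*) holds and `x` lies in the critical class, no such `M` is orthogonal to `x`, so the
conjugates of `x` span `L`. Conversely, `M` and its orthogonal meet at least `dim M` and `n - dim M`
classes of orders; `c ↦ δ - c` makes the two sets disjoint, so they fill `ℤ/n`. Normality of
critical elements keeps `δ` out of the orthogonal's set, so `0` belongs to that of `M`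
(`exists_dvd_normOrd_of_valuationCriterion`).

Suppose `X ^ p - ξ ^ p` splits over `K` for all `ξ`. Take `y` in `M` whose group `S` of
automorphisms acting on `y` by scalars is maximal, and let `E` be the fixed field of `S`. Maximality
makes `G/S` cyclic and forces a generator to act on `y` through an irreducible binomial, so the
conjugates of `y` span `E y`, which lies in `M` (`exists_fixedFieldLine_le`). Irreducibility is
where the exception at `2` enters. The line `E y` satisfies (*) exactly when the value of `y` is
attained on `E`. If `S` acts on `y` through all `r`-th roots of unity, then `E(y)/E` is cyclic of
degree `r` with `y ^ r` in `E`, and this is the unit root Kummer condition. Otherwise `S = G`, and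
`y` is a quotient of two eigenvectors with full characters.

If `p ≠ 0` in `K` and `K` has no primitive `p`-th root of unity, adjoin one, `ζ`. The degrees of
`K(ζ)/K` and `L(ζ)/L` are prime to `p`, so orders mod `n` and traces can still be compared, using
the Galois-invariant spectral valuation. For an eigenvector `α` the norm of `α` to `L` and a
`p`-power of `α` both lie in `E`; their values are coprime powers of that of `α`, so (*) holds over
`K(ζ)`, and normality descends. -/

open Polynomial

/-! ### Irreducible binomials, cyclic `p`-groups and roots of unity. -/

/-- If `-1` is a square and `a` is not, then `X ^ (2 ^ n) - a` is irreducible. -/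
theorem irreducible_X_pow_two_pow_sub_C {K : Type*} [Field K] {a i : K} (hi : i ^ 2 = -1)
    (ha : ∀ b : K, b ^ 2 ≠ a) (n : ℕ) : Irreducible (X ^ (2 ^ n) - C a) := by
  induction n with
  | zero => simpa using irreducible_X_sub_C a
  | succ n IH =>
    rw [pow_succ']
    refine X_pow_mul_sub_C_irreducible IH fun E _ _ x hx => ?_
    refine X_pow_sub_C_irreducible_of_prime Nat.prime_two fun b hb => ?_
    have hint : IsIntegral K x := not_not.mp fun h ↦ by
      simpa only [degree_zero, degree_X_pow_sub_C (Nat.two_pow_pos n),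
        WithBot.natCast_ne_bot] using congr_arg degree (hx.symm.trans (dif_neg h))
    have hN : (Algebra.norm K b) ^ 2 =
        (-1) ^ (2 ^ n) * -a := by
      rw [← map_pow, hb, ← IntermediateField.adjoin.powerBasis_gen hint,
        Algebra.PowerBasis.norm_gen_eq_coeff_zero_minpoly]
      have h0 : (0 : ℕ) ≠ 2 ^ n := (pow_ne_zero n two_ne_zero).symm
      simp [IntermediateField.minpoly_gen, hx, coeff_X_pow, h0]
    -- The norm of a square root of `x` squares to `a` if `n = 0` and to `-a` otherwise; in the
    -- second case `i` corrects the sign.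
    rcases Nat.eq_zero_or_pos n with rfl | hn
    · exact ha _ (by simpa using hN)
    · have h2 : Even (2 ^ n) := (Nat.even_pow' hn.ne').2 even_two
      refine ha (i * Algebra.norm K b) ?_
      rw [mul_pow, hN, hi, h2.neg_one_pow]
      simp

/-- If a product of linear factors in an endomorphism kills `y ≠ 0`, then the endomorphism has an
eigenvector among the polynomial translates of `y`. -/
theorem exists_aeval_eigenvector {K V : Type*} [Field K] [AddCommGroup V] [Module K V]
    (f : V →ₗ[K] V) (s : Multiset K) {y : V} (hy : y ≠ 0)
    (h : aeval f (s.map fun c => X - C c).prod y = 0) :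
    ∃ (Q : K[X]) (c : K), aeval f Q y ≠ 0 ∧ f (aeval f Q y) = c • aeval f Q y := by
  induction s using Multiset.induction with
  | empty => simp_all
  | cons c s IH =>
    by_cases h0 : aeval f (s.map fun c => X - C c).prod y = 0
    · exact IH h0
    · refine ⟨_, c, h0, ?_⟩
      rw [Multiset.map_cons, Multiset.prod_cons, map_mul, Module.End.mul_apply] at h
      rw [map_sub, aeval_X, aeval_C, LinearMap.sub_apply, Module.algebraMap_end_apply] at h
      exact sub_eq_zero.1 h

/-- A finite abelian `p`-group whose `p`-torsion is cyclic is cyclic. -/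
theorem isCyclic_of_cyclic_torsion {Q : Type*} [CommGroup Q] [Finite Q] {p : ℕ} [Fact p.Prime]
    (hQ : IsPGroup p Q)
    (h : ∀ a b : Q, a ^ p = 1 → b ^ p = 1 → a ≠ 1 → b ∈ Subgroup.zpowers a) : IsCyclic Q := by
  have hp : p.Prime := Fact.out
  obtain ⟨g, hg⟩ := Monoid.exists_orderOf_eq_exponent (Monoid.ExponentExists.of_finite (G := Q))
  refine ⟨g, fun b => ?_⟩
  induction hn : orderOf b using Nat.strong_induction_on generalizing b with
  | _ n IH =>
    by_cases hb : b = 1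
    · rw [hb]; exact ⟨0, by simp⟩
    have hlt : orderOf (b ^ p) < orderOf b := by
      obtain ⟨k, hk⟩ := IsPGroup.iff_orderOf.1 hQ b
      have hk0 : k ≠ 0 := by
        rintro rfl
        exact hb (orderOf_eq_one_iff.1 (by simpa using hk))
      rw [orderOf_pow_of_dvd hp.ne_zero (hk ▸ dvd_pow_self p hk0)]
      exact Nat.div_lt_self (orderOf_pos b) hp.one_lt
    have hmem := IH _ (hn ▸ hlt) (b ^ p) rfl
    obtain ⟨j, hj⟩ := mem_powers_iff_mem_zpowers.2 hmem
    simp only at hj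
    -- If `p ∣ j`, then `b` differs from a power of `g` by `p`-torsion, which lies in the group
    -- generated by `g ^ p ^ l`. If not, `b ^ p` has the order of `g`, which is maximal, although
    -- its order is below that of `b`.
    by_cases hpj : p ∣ j
    · obtain ⟨i, rfl⟩ := hpj
      have hg1 : g ≠ 1 := by
        rintro rfl
        apply hb
        have := Monoid.order_dvd_exponent b
        rw [← hg, orderOf_one, Nat.dvd_one] at this
        exact orderOf_eq_one_iff.1 this
      obtain ⟨l, hl⟩ := IsPGroup.iff_orderOf.1 hQ g
      have hl0 : l ≠ 0 := by
        rintro rfl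
        exact hg1 (orderOf_eq_one_iff.1 (by simpa using hl))
      obtain ⟨l, rfl⟩ := Nat.exists_eq_succ_of_ne_zero hl0
      have ha1 : (g ^ p ^ l) ^ p = 1 := by
        rw [← pow_mul, ← pow_succ, ← hl, pow_orderOf_eq_one]
      have ha2 : g ^ p ^ l ≠ 1 := by
        intro h1
        have := orderOf_dvd_of_pow_eq_one h1
        rw [hl, Nat.pow_dvd_pow_iff_le_right hp.one_lt] at this
        omega
      have hb1 : (b * (g ^ i)⁻¹) ^ p = 1 := by
        rw [mul_pow, ← hj, inv_pow, ← pow_mul, mul_comm p i, mul_inv_cancel]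
      have := h _ _ ha1 hb1 ha2
      have h2 : b * (g ^ i)⁻¹ ∈ Subgroup.zpowers g :=
        (Subgroup.zpowers_le.2 (pow_mem (Subgroup.mem_zpowers g) _)) this
      have := mul_mem h2 (pow_mem (Subgroup.mem_zpowers g) i)
      rw [inv_mul_cancel_right] at this
      exact this
    · obtain ⟨l, hl⟩ := IsPGroup.iff_orderOf.1 hQ g
      have hc : (orderOf g).Coprime j := by
        rw [hl]
        exact Nat.Coprime.pow_left _ ((Nat.Prime.coprime_iff_not_dvd hp).2 hpj)
      have h1 : orderOf (b ^ p) = orderOf g := by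
        rw [← hj, hc.orderOf_pow]
      have h2 : orderOf b ≤ orderOf g := by
        rw [hg]
        exact Nat.le_of_dvd (Nat.pos_of_ne_zero Monoid.exponent_ne_zero_of_finite)
          (Monoid.order_dvd_exponent b)
      omega

/-- In a field, a root of unity of `p`-power order which is not a `p`-th power generates the
roots of unity of this order. -/
theorem isPrimitiveRoot_card_of_not_pow {K : Type*} [Field K] {p k : ℕ} [Fact p.Prime] {c : K}
    (hc : c ^ p ^ k = 1) (hnp : ∀ ξ : K, ξ ^ p ≠ c) :
    IsPrimitiveRoot c (Nat.card (rootsOfUnity (p ^ k) K)) := by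
  have hp : p.Prime := Fact.out
  have : NeZero (p ^ k) := ⟨pow_ne_zero _ hp.ne_zero⟩
  obtain ⟨γ, hγ⟩ := IsCyclic.exists_generator (α := rootsOfUnity (p ^ k) K)
  have hr : orderOf γ = Nat.card (rootsOfUnity (p ^ k) K) := orderOf_eq_card_of_forall_mem_zpowers hγ
  obtain ⟨j, hj⟩ := mem_powers_iff_mem_zpowers.2 (hγ (rootsOfUnity.mkOfPowEq c hc))
  have hj' : ((γ : Kˣ) : K) ^ j = c := by
    have := congrArg (fun x : rootsOfUnity (p ^ k) K => ((x : Kˣ) : K)) hj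
    simpa using this
  have hpj : ¬ p ∣ j := by
    rintro ⟨i, rfl⟩
    exact hnp (((γ : Kˣ) : K) ^ i) (by rw [← hj', ← pow_mul, mul_comm])
  have hdvd : orderOf γ ∣ p ^ k := orderOf_dvd_of_pow_eq_one (by
    ext; simpa using congrArg Units.val γ.2)
  have hcop : (orderOf γ).Coprime j :=
    Nat.Coprime.coprime_dvd_left hdvd
      (Nat.Coprime.pow_left _ ((Nat.Prime.coprime_iff_not_dvd hp).2 hpj))
  have h1 := hcop.orderOf_pow
  have h2 : orderOf c = orderOf (γ ^ j) := by
    rw [← hj', ← Units.val_pow_eq_pow_val, orderOf_units, ← Subgroup.coe_pow, Subgroup.orderOf_coe]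
  rw [← hr, ← h1, ← h2]
  exact IsPrimitiveRoot.orderOf c

/-! ### Eigenvectors in stable subspaces. -/

section

variable (K : Type*) {L : Type*} [Field K] [Field L] [Algebra K L]

/-- The group of automorphisms that multiply `y` by an element of the base field. -/
def scalarStabilizer (y : L) : Subgroup Gal(L/K) where
  carrier := {g | ∃ c : K, g y = algebraMap K L c * y}
  one_mem' := ⟨1, by simp⟩
  mul_mem' := by
    rintro a b ⟨c, hc⟩ ⟨d, hd⟩
    exact ⟨d * c, by rw [AlgEquiv.mul_apply, hd, map_mul, hc, AlgEquiv.commutes, map_mul, mul_assoc]⟩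
  inv_mem' := by
    rintro a ⟨c, hc⟩
    by_cases hy : y = 0
    · exact ⟨1, by simp [hy]⟩
    have hc0 : c ≠ 0 := by
      rintro rfl
      simp [hy] at hc
    refine ⟨c⁻¹, ?_⟩
    change a.symm y = _
    rw [AlgEquiv.symm_apply_eq, map_mul, AlgEquiv.commutes, hc, ← mul_assoc, ← map_mul,
      inv_mul_cancel₀ hc0, map_one, one_mul]

variable {K}

theorem pow_apply_of_apply_eq {y : L} {g : Gal(L/K)} {c : K} (h : g y = algebraMap K L c * y)
    (n : ℕ) : (g ^ n) y = algebraMap K L (c ^ n) * y := by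
  induction n with
  | zero => simp
  | succ n IH =>
    rw [pow_succ, AlgEquiv.mul_apply, h, map_mul, AlgEquiv.commutes, IH, pow_succ, map_mul]
    ring

/-- Polynomial expressions in an automorphism preserve a stable subspace. -/
theorem aeval_mem_of_stable {M : Submodule K L} {g : Gal(L/K)} (hM : ∀ x ∈ M, g x ∈ M)
    (P : K[X]) {y : L} (hy : y ∈ M) : aeval g.toLinearMap P y ∈ M := by
  induction P using Polynomial.induction_on' with
  | add P Q hP hQ => rw [map_add, LinearMap.add_apply]; exact add_mem hP hQ
  | monomial n a =>
    rw [aeval_monomial, Module.End.mul_apply, Module.algebraMap_end_apply]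
    refine M.smul_mem _ ?_
    induction n with
    | zero => simpa using hy
    | succ n IH => rw [pow_succ', Module.End.mul_apply]; exact hM _ IH

theorem aeval_apply_comm {g h : Gal(L/K)} (hc : g * h = h * g) (P : K[X]) (y : L) :
    h (aeval g.toLinearMap P y) = aeval g.toLinearMap P (h y) := by
  have hc' : Commute g.toLinearMap h.toLinearMap := by
    ext x
    exact DFunLike.congr_fun hc x
  have h3 : Commute (aeval g.toLinearMap P) h.toLinearMap := by
    induction P using Polynomial.induction_on' with
    | add P Q hP hQ => rw [map_add]; exact hP.add_left hQ
    | monomial n a =>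
      rw [aeval_monomial]
      exact Commute.mul_left (Algebra.commutes a h.toLinearMap) (hc'.pow_left n)
  exact (LinearMap.congr_fun h3.eq y).symm

end

section

variable {K L : Type*} [Field K] [Field L] [Algebra K L]

theorem gal_comm [IsAbelianGalois K L] (g h : Gal(L/K)) : g * h = h * g :=
  IsMulCommutative.is_comm.comm g h

/-- The line over a fixed field spanned by an eigenvector. -/
def fixedFieldLine (S : Subgroup Gal(L/K)) (y : L) : Submodule K L :=
  (Subalgebra.toSubmodule (IntermediateField.fixedField S).toSubalgebra).map
    (LinearMap.mulRight K y)

theorem mem_fixedFieldLine {S : Subgroup Gal(L/K)} {y x : L} :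
    x ∈ fixedFieldLine S y ↔ ∃ e ∈ IntermediateField.fixedField S, e * y = x := by
  simp [fixedFieldLine]

theorem mem_fixedField {S : Subgroup Gal(L/K)} {x : L} :
    x ∈ IntermediateField.fixedField S ↔ ∀ h ∈ S, h x = x :=
  ⟨fun h g hg => h ⟨g, hg⟩, fun h g => h g g.2⟩

/-- As the group is abelian, `h` in `S` scales `y` and `g y` by the same constant, so `g y / y` lies
in the fixed field. -/
theorem fixedFieldLine_stable [IsAbelianGalois K L] {S : Subgroup Gal(L/K)} {y : L} (hy : y ≠ 0)
    (hS : ∀ h ∈ S, ∃ c : K, h y = algebraMap K L c * y) (g : Gal(L/K)) {x : L}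
    (hx : x ∈ fixedFieldLine S y) : g x ∈ fixedFieldLine S y := by
  rw [mem_fixedFieldLine] at hx ⊢
  obtain ⟨e, he, rfl⟩ := hx
  refine ⟨g e * (g y / y), mul_mem ?_ ?_, ?_⟩
  · rw [mem_fixedField] at he ⊢
    intro h hh
    rw [← AlgEquiv.mul_apply, gal_comm, AlgEquiv.mul_apply, he h hh]
  · rw [mem_fixedField]
    intro h hh
    obtain ⟨c, hc⟩ := hS h hh
    have hc0 : algebraMap K L c ≠ 0 := by
      rintro h0
      rw [h0, zero_mul] at hc
      exact hy (by simpa using hc)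
    rw [map_div₀, ← AlgEquiv.mul_apply, gal_comm, AlgEquiv.mul_apply, hc, map_mul,
      AlgEquiv.commutes, mul_div_mul_left _ _ hc0]
  · rw [map_mul, mul_assoc, div_mul_cancel₀ _ hy]

theorem finrank_fixedFieldLine [FiniteDimensional K L] [IsGalois K L] (S : Subgroup Gal(L/K))
    {y : L} (hy : y ≠ 0) : Module.finrank K (fixedFieldLine S y) = S.index := by
  have h1 : Module.finrank K (fixedFieldLine S y) =
      Module.finrank K (IntermediateField.fixedField S) :=
    (Submodule.equivMapOfInjective (LinearMap.mulRight K y) (mul_left_injective₀ hy)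
      _).symm.finrank_eq
  have h2 := Module.finrank_mul_finrank K (IntermediateField.fixedField S) L
  rw [IntermediateField.finrank_fixedField_eq_card, ← IsGalois.card_aut_eq_finrank K L,
    ← Subgroup.index_mul_card S] at h2
  rw [h1]
  exact Nat.eq_of_mul_eq_mul_right Nat.card_pos h2

/-- If `X ^ q - c` is irreducible and `g ^ q` multiplies `y` by `c`, then polynomial expressions
of degree less than `q` in `g` act faithfully on `y`. -/
theorem finrank_map_degreeLT {y : L} (hy : y ≠ 0) {g : Gal(L/K)} {q : ℕ} {c : K}
    (hirr : Irreducible (X ^ q - C c)) (hg : (g ^ q) y = algebraMap K L c * y) :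
    Module.finrank K ((degreeLT K q).map
      ((LinearMap.applyₗ y).comp (aeval g.toLinearMap).toLinearMap)) = q := by
  have hq : q ≠ 0 := ne_zero_of_irreducible_X_pow_sub_C hirr
  have h0 : aeval g.toLinearMap (X ^ q - C c) y = 0 := by
    have : (g.toLinearMap ^ q) y = (g ^ q) y := by
      clear hg hirr hq
      induction q with
      | zero => simp
      | succ n IH =>
        rw [pow_succ', pow_succ', Module.End.mul_apply, IH]; rfl
    rw [map_sub, map_pow, aeval_X, aeval_C, LinearMap.sub_apply, Module.algebraMap_end_apply,
      this, hg, Algebra.smul_def, sub_self]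
  have hinj : Function.Injective (((LinearMap.applyₗ y).comp
      (aeval (R := K) g.toLinearMap).toLinearMap).domRestrict (degreeLT K q)) := by
    rw [← LinearMap.ker_eq_bot, LinearMap.ker_eq_bot']
    rintro ⟨P, hP⟩ h
    rw [Subtype.ext_iff]
    by_contra hP0
    change P ≠ 0 at hP0
    replace h : aeval g.toLinearMap P y = 0 := h
    have hdeg : P.degree < (X ^ q - C c).degree := by
      rw [degree_X_pow_sub_C (Nat.pos_of_ne_zero hq)]
      exact mem_degreeLT.1 hP
    -- Both polynomials kill `y`; a Bézout relation between them would kill `y` by `1`.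
    have hcop : IsCoprime (X ^ q - C c) P :=
      (Irreducible.coprime_iff_not_dvd hirr).2 fun hd =>
        absurd (degree_le_of_dvd hd hP0) (not_le.2 hdeg)
    obtain ⟨A, B, hAB⟩ := hcop
    have := congrArg (fun F => aeval g.toLinearMap F y) hAB
    simp only [map_add, map_mul, LinearMap.add_apply, Module.End.mul_apply, h0, h, map_zero,
      map_one, Module.End.one_apply, add_zero] at this
    exact hy this.symm
  have := LinearMap.finrank_range_of_inj hinj
  rw [LinearMap.range_domRestrict] at this
  rw [this, (degreeLTEquiv K q).finrank_eq]
  simp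

/-- A root of unity of `p`-power order that is not a `p`-th power gives irreducible binomials, unless
`p = 2`, `8 ∣ p ^ k` and `±1` are the only `p ^ k`-th roots of unity. -/
theorem irreducible_of_not_pow {p : ℕ} [Fact p.Prime] {k j : ℕ} {c : K}
    (h2 : p = 2 → 8 ∣ p ^ k → Nat.card (rootsOfUnity (p ^ k) K) ≠ 2)
    (hc : c ^ p ^ k = 1) (hnp : ∀ ξ : K, ξ ^ p ≠ c) (hjk : p ^ (j + 1) ∣ p ^ k) :
    Irreducible (X ^ p ^ j - C c) := by
  have hp : p.Prime := Fact.out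
  by_cases hp2 : p = 2
  · subst hp2
    have hprim := isPrimitiveRoot_card_of_not_pow hc hnp
    have hr : Nat.card (rootsOfUnity (2 ^ k) K) ∣ 2 ^ k := hprim.dvd_of_pow_eq_one _ hc
    obtain ⟨l, -, hl⟩ := (Nat.dvd_prime_pow hp).1 hr
    rw [hl] at hprim
    match l, hl, hprim with
    | 0, _, hprim => exact absurd (by simpa using hprim : c = 1).symm (by simpa using hnp 1)
    | 1, hl, hprim =>
      -- Here `r = 2`, so the hypothesis excludes `8 ∣ 2 ^ k`; only linear and quadratic binomials
      -- remain.
      have hj : j < 2 := by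
        by_contra hj
        refine h2 rfl ((pow_dvd_pow 2 (by omega : 3 ≤ j + 1)).trans hjk) (by simpa using hl)
      interval_cases j
      · simpa using irreducible_X_sub_C c
      · simpa using X_pow_sub_C_irreducible_of_prime hp hnp
    | l + 2, _, hprim =>
      -- Now `4 ∣ r`, so `-1` is a square in `K`.
      have h4 : IsPrimitiveRoot (c ^ 2 ^ l) 4 :=
        hprim.pow (by positivity) (by rw [pow_add]; norm_num)
      have hm1 : IsPrimitiveRoot ((c ^ 2 ^ l) ^ 2) 2 := h4.pow (by norm_num) (by norm_num)
      exact irreducible_X_pow_two_pow_sub_C hm1.eq_neg_one_of_two_right hnp j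
  · exact X_pow_sub_C_irreducible_of_prime_pow hp hp2 j hnp

end

section

variable {K L : Type*} [Field K] [Field L] [Algebra K L]

/-- Elements of a stable subspace whose scalar stabilizer is maximal. -/
theorem exists_maximal_scalarStabilizer [FiniteDimensional K L] {M : Submodule K L} (hM : M ≠ ⊥) :
    ∃ y ∈ M, y ≠ 0 ∧ ∀ z ∈ M, z ≠ 0 → scalarStabilizer K y ≤ scalarStabilizer K z →
      scalarStabilizer K z ≤ scalarStabilizer K y := by
  obtain ⟨x, hx, hx0⟩ := M.ne_bot_iff.1 hM
  obtain ⟨S, ⟨y, hy, hy0, rfl⟩, hS⟩ :=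
    (Set.toFinite {S : Subgroup Gal(L/K) | ∃ y ∈ M, y ≠ 0 ∧ scalarStabilizer K y = S}).exists_maximal
      ⟨_, x, hx, hx0, rfl⟩
  exact ⟨y, hy, hy0, fun z hz hz0 hle => hS ⟨z, hz, hz0, rfl⟩ hle⟩

/-- At an element with maximal scalar stabilizer, an automorphism outside the stabilizer whose
`p`-th power lies in it has a `p`-th power acting by a non-`p`-th power. -/
theorem not_pow_of_maximal [IsAbelianGalois K L] {p : ℕ}
    (hsplit : ∀ ξ : K, (X ^ p - C (ξ ^ p)).Splits) (hp : p ≠ 0)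
    {M : Submodule K L} (hM : ∀ g : Gal(L/K), ∀ x ∈ M, g x ∈ M) {y : L} (hy : y ∈ M) (hy0 : y ≠ 0)
    (hmax : ∀ z ∈ M, z ≠ 0 → scalarStabilizer K y ≤ scalarStabilizer K z →
      scalarStabilizer K z ≤ scalarStabilizer K y)
    {g : Gal(L/K)} (hg : g ∉ scalarStabilizer K y) {c : K}
    (hc : (g ^ p) y = algebraMap K L c * y) (ξ : K) : ξ ^ p ≠ c := by
  rintro rfl
  have hpow : ∀ n, (g.toLinearMap ^ n) y = (g ^ n) y := by
    intro n
    induction n with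
    | zero => simp
    | succ n IH => rw [pow_succ', pow_succ', Module.End.mul_apply, IH]; rfl
  have h0 : aeval g.toLinearMap (X ^ p - C (ξ ^ p)) y = 0 := by
    rw [map_sub, map_pow, aeval_X, aeval_C, LinearMap.sub_apply, Module.algebraMap_end_apply,
      hpow, hc, Algebra.smul_def, sub_self]
  rw [(hsplit ξ).eq_prod_roots_of_monic (monic_X_pow_sub_C _ hp)] at h0
  obtain ⟨Q, d, hQ, hQd⟩ := exists_aeval_eigenvector g.toLinearMap _ hy0 h0
  -- The eigenvector is a polynomial in `g` applied to `y`; it stays in `M` and, by commutativity,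
  -- keeps the scalars of `y`. Its stabilizer also contains `g`, against maximality.
  refine hg (hmax _ (aeval_mem_of_stable (hM g) Q hy) hQ ?_ ⟨d, ?_⟩)
  · rintro h ⟨e, he⟩
    refine ⟨e, ?_⟩
    rw [aeval_apply_comm (gal_comm g h), he, ← Algebra.smul_def, map_smul, Algebra.smul_def]
  · rw [← Algebra.smul_def]
    exact hQd

/-- Let `L/K` be abelian of `p`-power degree such that `X ^ p - 1` splits in `K`. A non-zero stable
subspace of `L` contains the line over a fixed field spanned by an eigenvector; the group of the
fixed field is everything or acts through a generator of the relevant roots of unity. -/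
theorem exists_fixedFieldLine_le [FiniteDimensional K L] [IsAbelianGalois K L] {p k : ℕ}
    [Fact p.Prime] (hexp : Monoid.exponent Gal(L/K) = p ^ k)
    (hsplit : ∀ ξ : K, (X ^ p - C (ξ ^ p)).Splits)
    (h2 : p = 2 → 8 ∣ p ^ k → Nat.card (rootsOfUnity (p ^ k) K) ≠ 2)
    {M : Submodule K L} (hM : ∀ g : Gal(L/K), ∀ x ∈ M, g x ∈ M) (hM0 : M ≠ ⊥) :
    ∃ y, y ≠ 0 ∧ fixedFieldLine (scalarStabilizer K y) y ≤ M ∧ (scalarStabilizer K y = ⊤ ∨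
      ∃ (h : Gal(L/K)) (ζ : K), IsPrimitiveRoot ζ (Nat.card (rootsOfUnity (p ^ k) K)) ∧
        h y = algebraMap K L ζ * y) := by
  have hp : p.Prime := Fact.out
  obtain ⟨y, hy, hy0, hmax⟩ := exists_maximal_scalarStabilizer hM0
  set S := scalarStabilizer K y with hS
  have hscalar : ∀ {g : Gal(L/K)} {c : K}, g y = algebraMap K L c * y → c ^ p ^ k = 1 := by
    intro g c hc
    have h := pow_apply_of_apply_eq hc (p ^ k)
    rw [← hexp, Monoid.pow_exponent_eq_one, AlgEquiv.one_apply, hexp] at h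
    have h' := mul_right_cancel₀ hy0 ((one_mul y).trans h)
    rw [← map_one (algebraMap K L)] at h'
    exact ((algebraMap K L).injective h').symm
  have hnp : ∀ {g : Gal(L/K)}, g ∉ S → ∀ {c : K}, (g ^ p) y = algebraMap K L c * y →
      ∀ ξ : K, ξ ^ p ≠ c := fun hg _ hc =>
    not_pow_of_maximal hsplit hp.ne_zero hM hy hy0 hmax hg hc
  let _ : CommGroup Gal(L/K) := { (inferInstance : Group Gal(L/K)) with mul_comm := gal_comm }
  have hG : IsPGroup p Gal(L/K) := fun g => ⟨k, by rw [← hexp, Monoid.pow_exponent_eq_one]⟩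
  have hcyc : IsCyclic (Gal(L/K) ⧸ S) := by
    refine isCyclic_of_cyclic_torsion (p := p) (hG.to_quotient S) ?_
    intro a b
    induction a using QuotientGroup.induction_on with | _ a
    induction b using QuotientGroup.induction_on with | _ b
    intro ha hb ha1
    rw [← QuotientGroup.mk_pow, QuotientGroup.eq_one_iff] at ha hb
    rw [ne_eq, QuotientGroup.eq_one_iff] at ha1
    obtain ⟨c, hc⟩ := ha
    obtain ⟨d, hd⟩ := hb
    have hprim := isPrimitiveRoot_card_of_not_pow (hscalar hc) (hnp ha1 hc)
    have : NeZero (p ^ k) := ⟨pow_ne_zero _ hp.ne_zero⟩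
    have : NeZero (Nat.card (rootsOfUnity (p ^ k) K)) := ⟨Nat.card_pos.ne'⟩
    have hdr : d ^ Nat.card (rootsOfUnity (p ^ k) K) = 1 := by
      have h := pow_card_eq_one' (x := rootsOfUnity.mkOfPowEq d (hscalar hd))
      simpa using congrArg (fun x : rootsOfUnity (p ^ k) K => ((x : Kˣ) : K)) h
    obtain ⟨i, -, hi⟩ := hprim.eq_pow_of_pow_eq_one hdr
    -- The scalar `c` of `a ^ p` generates the roots of unity, so the scalar of `b ^ p` is `c ^ i`.
    -- Then the `p`-th power of `b / a ^ i` acts by `1`, a `p`-th power.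
    have hbi : (b * (a ^ i)⁻¹) ∈ S := by
      by_contra hbi
      refine hnp hbi (c := 1) ?_ 1 (one_pow p)
      have hc0 : algebraMap K L (c ^ i) ≠ 0 := by
        simpa using fun h => absurd h (hprim.ne_zero (NeZero.ne _))
      have h1 : ((a ^ p) ^ i) y = algebraMap K L (c ^ i) * y := pow_apply_of_apply_eq hc i
      have h3 : (b * (a ^ i)⁻¹) ^ p = ((a ^ p) ^ i)⁻¹ * b ^ p := by
        rw [mul_pow, inv_pow, ← pow_mul, ← pow_mul, mul_comm i p, mul_comm (b ^ p)]
      rw [h3, AlgEquiv.mul_apply, hd, ← hi, ← h1, map_one, one_mul]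
      exact ((a ^ p) ^ i).symm_apply_apply y
    refine Subgroup.mem_zpowers_iff.2 ⟨i, ?_⟩
    rw [zpow_natCast, ← QuotientGroup.mk_pow, eq_comm, QuotientGroup.eq_iff_div_mem, div_eq_mul_inv]
    exact hbi
  obtain ⟨γ, hγ⟩ := hcyc.exists_generator
  induction γ using QuotientGroup.induction_on with | _ g
  have hord : orderOf (g : Gal(L/K) ⧸ S) = S.index := orderOf_eq_card_of_forall_mem_zpowers hγ
  obtain ⟨j, hj⟩ := IsPGroup.iff_orderOf.1 (hG.to_quotient S) (g : Gal(L/K) ⧸ S)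
  have hmemS : ∀ n, g ^ n ∈ S ↔ p ^ j ∣ n := by
    intro n
    rw [← QuotientGroup.eq_one_iff, QuotientGroup.mk_pow, ← hj, orderOf_dvd_iff_pow_eq_one]
  obtain ⟨c, hc⟩ := (hmemS (p ^ j)).2 dvd_rfl
  have hnpc : j ≠ 0 → ∀ ξ : K, ξ ^ p ≠ c := by
    intro hj0
    obtain ⟨i, rfl⟩ := Nat.exists_eq_succ_of_ne_zero hj0
    refine hnp (g := g ^ p ^ i) ?_ ?_
    · rw [hmemS, Nat.pow_dvd_pow_iff_le_right hp.one_lt]; omega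
    · rw [← pow_mul, ← pow_succ, hc]
  have hirr : Irreducible (X ^ p ^ j - C c) := by
    by_cases hj0 : j = 0
    · subst hj0
      simpa using irreducible_X_sub_C c
    refine irreducible_of_not_pow h2 (hscalar hc) (hnpc hj0) ?_
    obtain ⟨l, hl⟩ := IsPGroup.iff_orderOf.1 hG g
    have hlk : p ^ l ∣ p ^ k := by
      rw [← hl, ← hexp]; exact Monoid.order_dvd_exponent g
    refine dvd_trans (pow_dvd_pow p ?_) hlk
    -- If the order of `g` were at most `p ^ j`, then `c = 1` would be a `p`-th power.
    by_contra hlt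
    have h1 : g ^ p ^ j = 1 := by
      rw [← orderOf_dvd_iff_pow_eq_one, hl]
      exact pow_dvd_pow p (by omega)
    rw [h1, AlgEquiv.one_apply] at hc
    have h' := mul_right_cancel₀ hy0 ((one_mul y).trans hc)
    rw [← map_one (algebraMap K L)] at h'
    exact hnpc hj0 1 (by rw [one_pow]; exact (algebraMap K L).injective h')
  have hfin := finrank_map_degreeLT hy0 hirr hc
  have hsub : ∀ N : Submodule K L, (∀ x ∈ N, g x ∈ N) → y ∈ N → (degreeLT K (p ^ j)).map
      ((LinearMap.applyₗ y).comp (aeval g.toLinearMap).toLinearMap) ≤ N := by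
    rintro N hN hyN _ ⟨P, -, rfl⟩
    exact aeval_mem_of_stable hN P hyN
  refine ⟨y, hy0, ?_, ?_⟩
  · have hle := hsub (fixedFieldLine S y)
      (fun x hx => fixedFieldLine_stable hy0 (fun h hh => hh) g hx)
      (mem_fixedFieldLine.2 ⟨1, one_mem _, one_mul y⟩)
    -- The polynomial translates of `y` and the line both have dimension `p ^ j`, the index of `S`.
    rw [← Submodule.eq_of_le_of_finrank_eq hle (by
      rw [hfin, finrank_fixedFieldLine S hy0, ← hord, hj])]
    exact hsub M (hM g) hy
  · by_cases hj0 : j = 0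
    · left
      rw [hj0, pow_zero, hord] at hj
      exact Subgroup.index_eq_one.1 hj
    · exact Or.inr ⟨_, c, isPrimitiveRoot_card_of_not_pow (hscalar hc) (hnpc hj0), hc⟩

end

/-! ### Valuation-independent families and normalized orders. -/

section General

variable {K L Γ₀ ι : Type*} [Field K] [Field L] [Algebra K L] [LinearOrderedCommGroupWithZero Γ₀]
  [Finite ι]

/-- A family whose non-zero members have distinct values has a dominant member. -/
theorem Valuation.exists_dominant (u : Valuation L Γ₀) {t : ι → L}
    (ht : ∀ i j, t i ≠ 0 → t j ≠ 0 → u (t i) = u (t j) → i = j) (hne : ∃ i, t i ≠ 0) :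
    ∃ i, t i ≠ 0 ∧ ∀ j, j ≠ i → u (t j) < u (t i) := by
  obtain ⟨i₀, hi₀⟩ := hne
  have : Nonempty ι := ⟨i₀⟩
  obtain ⟨i, hi⟩ := Finite.exists_max fun i => u (t i)
  have hi0 : t i ≠ 0 := by
    intro h
    have := hi i₀
    simp only [h, map_zero, le_zero_iff, map_eq_zero] at this
    exact hi₀ this
  refine ⟨i, hi0, fun j hj => lt_of_le_of_ne (hi j) fun h => hj ?_⟩
  refine ht j i ?_ hi0 h
  rintro h0
  rw [h0, map_zero, eq_comm, map_eq_zero] at h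
  exact hi0 h

/-- The values of scalar multiples of distinct members of `b` are distinct. -/
def IsValuationIndependent (K : Type*) {L Γ₀ ι : Type*} [Field K] [Field L] [Algebra K L]
    [LinearOrderedCommGroupWithZero Γ₀] (u : Valuation L Γ₀) (b : ι → L) : Prop :=
  ∀ i j (a c : K), a ≠ 0 → c ≠ 0 → u (a • b i) = u (c • b j) → i = j

/-- A vanishing non-trivial combination would have the value of its unique dominant term, which is
not zero. -/
theorem IsValuationIndependent.linearIndependent {u : Valuation L Γ₀} {b : ι → L}
    (h : IsValuationIndependent K u b) (hb : ∀ i, b i ≠ 0) : LinearIndependent K b := by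
  have := Fintype.ofFinite ι
  classical
  rw [Fintype.linearIndependent_iff]
  intro g hg
  by_contra! hne
  obtain ⟨i, hi, hdom⟩ := u.exists_dominant (t := fun i => g i • b i)
    (fun i j hi hj => h i j _ _ (left_ne_zero_of_smul hi) (left_ne_zero_of_smul hj))
    (hne.imp fun i hi => smul_ne_zero hi (hb i))
  have := u.map_sum_eq_of_lt (s := Finset.univ) (f := fun i => g i • b i) (Finset.mem_univ i)
    (fun j hj => hdom j (by simpa using hj))
  rw [hg, map_zero, eq_comm, map_eq_zero] at this
  exact hi this

theorem IsValuationIndependent.exists_dominant {u : Valuation L Γ₀} {b : Module.Basis ι K L}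
    (h : IsValuationIndependent K u b) {x : L} (hx : x ≠ 0) :
    ∃ i, b.repr x i ≠ 0 ∧ (∀ j, j ≠ i → u (b.repr x j • b j) < u (b.repr x i • b i)) ∧
      u x = u (b.repr x i • b i) := by
  have := Fintype.ofFinite ι
  classical
  obtain ⟨i, hi, hdom⟩ := u.exists_dominant (t := fun i => b.repr x i • b i)
    (fun i j hi hj => h i j _ _ (left_ne_zero_of_smul hi) (left_ne_zero_of_smul hj)) (by
      by_contra! h0
      apply hx
      rw [← b.sum_repr x]
      exact Finset.sum_eq_zero fun i _ => h0 i)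
  refine ⟨i, left_ne_zero_of_smul hi, hdom, ?_⟩
  rw [← u.map_sum_eq_of_lt (s := Finset.univ) (f := fun i => b.repr x i • b i) (Finset.mem_univ i)
    (fun j hj => hdom j (by simpa using hj)), b.sum_repr]

theorem IsValuationIndependent.repr_le {u : Valuation L Γ₀} {b : Module.Basis ι K L}
    (h : IsValuationIndependent K u b) (x : L) (i : ι) : u (b.repr x i • b i) ≤ u x := by
  by_cases hx : x = 0
  · simp [hx]
  obtain ⟨j, -, hj, hxj⟩ := h.exists_dominant hx
  rw [hxj]
  by_cases hij : i = j
  · rw [hij]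
  · exact (hj i hij).le

end General

section NormOrd

variable {E : Type*} [Field E] {w : Valuation E ℤᵐ⁰}

theorem valueSubgroup_eq_top (hw : Function.Surjective w) : valueSubgroup w = ⊤ :=
  (AddSubgroup.eq_top_iff' _).2 fun n => hw (WithZero.exp n)

theorem val_eq_exp (hw : Function.Surjective w) {x : E} (hx : x ≠ 0) :
    w x = WithZero.exp (-normOrd w x) := by
  rw [normOrd, valueSubgroup_eq_top hw, AddSubgroup.index_top]
  simp [WithZero.exp_log ((w.ne_zero_iff).2 hx)]

theorem normOrd_eq_iff (hw : Function.Surjective w) {x : E} (hx : x ≠ 0) {n : ℤ} :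
    normOrd w x = n ↔ w x = WithZero.exp (-n) := by
  rw [val_eq_exp hw hx, WithZero.exp_inj, neg_inj]

theorem normOrd_mul (hw : Function.Surjective w) {x y : E} (hx : x ≠ 0) (hy : y ≠ 0) :
    normOrd w (x * y) = normOrd w x + normOrd w y := by
  rw [normOrd_eq_iff hw (mul_ne_zero hx hy), map_mul, val_eq_exp hw hx, val_eq_exp hw hy,
    ← WithZero.exp_add, neg_add]

theorem normOrd_pow (hw : Function.Surjective w) {x : E} (hx : x ≠ 0) (n : ℕ) :
    normOrd w (x ^ n) = n * normOrd w x := by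
  rw [normOrd_eq_iff hw (pow_ne_zero n hx), map_pow, val_eq_exp hw hx, ← WithZero.exp_nsmul]
  simp

theorem normOrd_zpow (hw : Function.Surjective w) {x : E} (hx : x ≠ 0) (n : ℤ) :
    normOrd w (x ^ n) = n * normOrd w x := by
  rw [normOrd_eq_iff hw (zpow_ne_zero n hx), map_zpow₀, val_eq_exp hw hx, ← WithZero.exp_zsmul]
  simp

theorem val_lt_iff (hw : Function.Surjective w) {x y : E} (hx : x ≠ 0) (hy : y ≠ 0) :
    w x < w y ↔ normOrd w y < normOrd w x := by
  rw [val_eq_exp hw hx, val_eq_exp hw hy, WithZero.exp_lt_exp, neg_lt_neg_iff]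

theorem val_eq_iff (hw : Function.Surjective w) {x y : E} (hx : x ≠ 0) (hy : y ≠ 0) :
    w x = w y ↔ normOrd w x = normOrd w y := by
  rw [val_eq_exp hw hx, val_eq_exp hw hy, WithZero.exp_inj, neg_inj]

theorem val_le_one_iff (hw : Function.Surjective w) {x : E} (hx : x ≠ 0) :
    w x ≤ 1 ↔ 0 ≤ normOrd w x := by
  rw [val_eq_exp hw hx, ← WithZero.exp_zero, WithZero.exp_le_exp, neg_nonpos]

end NormOrd

/-! ### Orders in totally ramified extensions. -/

section TotallyRamified

variable {K L : Type*} [Field K] [Field L] [Algebra K L] {w : Valuation L ℤᵐ⁰}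

/-- The value group of `K` has index `[L:K]` in `ℤ`, and a subgroup of `ℤ` is determined by its
index. -/
theorem exists_normOrd_algebraMap_iff [FiniteDimensional K L] (hw : Function.Surjective w)
    (hram : IsTotallyRamified K w) {j : ℤ} :
    (∃ k : K, k ≠ 0 ∧ normOrd w (algebraMap K L k) = j) ↔ (Module.finrank K L : ℤ) ∣ j := by
  have h1 : (valueSubgroup (w.comap (algebraMap K L))).index = Module.finrank K L := by
    rw [← hram, ramificationIndex, valueSubgroup_eq_top hw, AddSubgroup.relIndex_top_right]
  obtain ⟨a, ha⟩ := Int.subgroup_cyclic (valueSubgroup (w.comap (algebraMap K L)))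
  rw [← AddSubgroup.zmultiples_eq_closure] at ha
  rw [ha, Int.index_zmultiples] at h1
  rw [← h1, Int.natAbs_dvd, ← Int.mem_zmultiples_iff, ← neg_mem_iff, ← ha]
  constructor
  · rintro ⟨k, hk, hkj⟩
    exact ⟨k, (normOrd_eq_iff hw (by simpa using hk)).1 hkj⟩
  · rintro ⟨k, hk⟩
    have hk0 : k ≠ 0 := by
      rintro rfl
      simp at hk
      exact WithZero.exp_ne_zero hk.symm
    exact ⟨k, hk0, (normOrd_eq_iff hw (by simpa using hk0)).2 hk⟩

/-- Scalars move orders by multiples of the degree, and the exponents `0, ..., [L:K] - 1` are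
pairwise incongruent. -/
theorem isValuationIndependent_of_normOrd [FiniteDimensional K L] (hw : Function.Surjective w)
    (hram : IsTotallyRamified K w) {π : L} (hπ : normOrd w π = 1) (hπ0 : π ≠ 0) :
    IsValuationIndependent K w fun i : Fin (Module.finrank K L) => π ^ (i : ℕ) := by
  intro i j a c ha hc h
  simp only [Algebra.smul_def] at h
  have ha' : algebraMap K L a ≠ 0 := by simpa using ha
  have hc' : algebraMap K L c ≠ 0 := by simpa using hc
  have hi := pow_ne_zero (i : ℕ) hπ0
  have hj := pow_ne_zero (j : ℕ) hπ0
  rw [val_eq_iff hw (mul_ne_zero ha' hi) (mul_ne_zero hc' hj), normOrd_mul hw ha' hi,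
    normOrd_mul hw hc' hj, normOrd_pow hw hπ0, normOrd_pow hw hπ0, hπ] at h
  have h1 := (exists_normOrd_algebraMap_iff hw hram).1 ⟨a, ha, rfl⟩
  have h2 := (exists_normOrd_algebraMap_iff hw hram).1 ⟨c, hc, rfl⟩
  have h3 : (Module.finrank K L : ℤ) ∣ (i : ℤ) - j := by
    have := dvd_sub h2 h1
    rwa [show (i : ℤ) - j = normOrd w (algebraMap K L c) - normOrd w (algebraMap K L a) by linarith]
  have := Int.eq_zero_of_abs_lt_dvd h3 (by rw [abs_lt]; constructor <;> omega)
  ext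
  omega

theorem exists_uniformizer (hw : Function.Surjective w) : ∃ π : L, π ≠ 0 ∧ normOrd w π = 1 := by
  obtain ⟨π, hπ⟩ := hw (WithZero.exp (-1))
  have hπ0 : π ≠ 0 := by
    rintro rfl
    rw [map_zero] at hπ
    exact WithZero.exp_ne_zero hπ.symm
  exact ⟨π, hπ0, (normOrd_eq_iff hw hπ0).2 hπ⟩

/-- The powers of an element with independent values form a basis. -/
noncomputable def powBasis [FiniteDimensional K L] {Γ₀ : Type*} [LinearOrderedCommGroupWithZero Γ₀]
    {u : Valuation L Γ₀} {π : L} {n : ℕ} (hn : n = Module.finrank K L) (hπ0 : π ≠ 0)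
    (h : IsValuationIndependent K u fun i : Fin n => π ^ (i : ℕ)) :
    Module.Basis (Fin n) K L :=
  have : Nonempty (Fin n) := ⟨⟨0, hn ▸ Module.finrank_pos⟩⟩
  basisOfLinearIndependentOfCardEqFinrank (h.linearIndependent fun i => pow_ne_zero _ hπ0)
    (by simpa using hn)

@[simp]
theorem coe_powBasis [FiniteDimensional K L] {Γ₀ : Type*} [LinearOrderedCommGroupWithZero Γ₀]
    {u : Valuation L Γ₀} {π : L} {n : ℕ} (hn : n = Module.finrank K L) (hπ0 : π ≠ 0)
    (h : IsValuationIndependent K u fun i : Fin n => π ^ (i : ℕ)) :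
    ⇑(powBasis hn hπ0 h) = fun i : Fin n => π ^ (i : ℕ) := by
  simp [powBasis]

/-- A stable count: a subspace meets at least as many residue classes of the order as its
dimension. -/
theorem finrank_le_ncard_normOrd [FiniteDimensional K L] (hw : Function.Surjective w)
    (hram : IsTotallyRamified K w) (M : Submodule K L) :
    Module.finrank K M ≤
      {c : ZMod (Module.finrank K L) | ∃ x ∈ M, x ≠ 0 ∧ (normOrd w x : ZMod _) = c}.ncard := by
  have : NeZero (Module.finrank K L) := ⟨Module.finrank_pos.ne'⟩
  obtain ⟨π, hπ0, hπ⟩ := exists_uniformizer hw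
  have hind := isValuationIndependent_of_normOrd hw hram hπ hπ0
  set b := powBasis rfl hπ0 hind with hb
  have hbi : IsValuationIndependent K w b := by rw [hb, coe_powBasis]; exact hind
  have hclass : ∀ x : L, ∀ i, b.repr x i ≠ 0 → w x = w (b.repr x i • b i) →
      (normOrd w x : ZMod (Module.finrank K L)) = ((i : ℕ) : ZMod (Module.finrank K L)) := by
    intro x i hi hxi
    have hi' : algebraMap K L (b.repr x i) ≠ 0 := by simpa using hi
    have hx : x ≠ 0 := by
      rintro rfl
      simp at hi
    have hpi := pow_ne_zero (i : ℕ) hπ0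
    rw [hb, coe_powBasis, ← hb, Algebra.smul_def, val_eq_iff hw hx (mul_ne_zero hi' hpi),
      normOrd_mul hw hi' hpi, normOrd_pow hw hπ0, hπ, mul_one] at hxi
    rw [hxi]
    push_cast
    rw [(ZMod.intCast_zmod_eq_zero_iff_dvd _ _).2
      ((exists_normOrd_algebraMap_iff hw hram).1 ⟨_, hi, rfl⟩), zero_add]
  induction hd : Module.finrank K M using Nat.strong_induction_on generalizing M with
  | _ d IH =>
    by_cases hM : M = ⊥
    · subst hM
      simp at hd
      omega
    obtain ⟨x, hx, hx0⟩ := M.ne_bot_iff.1 hM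
    obtain ⟨i, hi, -, hxi⟩ := hbi.exists_dominant hx0
    -- Killing the dominant coordinate of `x` costs at most one dimension and removes the class of
    -- `x`, since the class of an element is the index of its dominant coordinate.
    set N : Submodule K L := M ⊓ LinearMap.ker (b.coord i) with hN
    have hfin : d ≤ Module.finrank K N + 1 := by
      have h1 := LinearMap.finrank_range_add_finrank_ker ((b.coord i).comp M.subtype)
      have h2 : Module.finrank K (LinearMap.range ((b.coord i).comp M.subtype)) ≤ 1 :=
        (Submodule.finrank_le _).trans (by simp)
      have h3 : Module.finrank K (LinearMap.ker ((b.coord i).comp M.subtype)) =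
          Module.finrank K N := by
        have e : N = (LinearMap.ker ((b.coord i).comp M.subtype)).map M.subtype := by
          rw [LinearMap.ker_comp, Submodule.map_comap_subtype]
        rw [e]
        exact (Submodule.equivMapOfInjective _ M.injective_subtype _).finrank_eq
      omega
    have hlt : Module.finrank K N < d := by
      rw [← hd]
      refine Submodule.finrank_lt_finrank_of_lt (lt_of_le_of_ne inf_le_left fun h => ?_)
      rw [← h] at hx
      exact hi hx.2
    have hIH := IH _ hlt N rfl
    refine hfin.trans ((Nat.add_le_add_right hIH 1).trans ?_)
    have hnot : ((i : ℕ) : ZMod (Module.finrank K L)) ∉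
        {c : ZMod (Module.finrank K L) | ∃ x ∈ N, x ≠ 0 ∧ (normOrd w x : ZMod _) = c} := by
      rintro ⟨z, hz, hz0, hzi⟩
      obtain ⟨j, hj, -, hzj⟩ := hbi.exists_dominant hz0
      rw [hclass z j hj hzj, ZMod.natCast_eq_natCast_iff'] at hzi
      rw [Nat.mod_eq_of_lt j.2, Nat.mod_eq_of_lt i.2] at hzi
      rw [Fin.ext hzi] at hj
      exact hj hz.2
    rw [← Set.ncard_insert_of_notMem hnot (Set.toFinite _)]
    refine Set.ncard_le_ncard ?_ (Set.toFinite _)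
    rintro c (rfl | ⟨z, hz, hz0, hzc⟩)
    · exact ⟨x, hx, hx0, hclass x i hi hxi⟩
    · exact ⟨z, hz.1, hz0, hzc⟩

end TotallyRamified

/-! ### Normality through the trace form. -/

section NormalBasis

variable {K L : Type*} [Field K] [Field L] [Algebra K L]

theorem orthogonal_traceForm_stable {M : Submodule K L} (hM : ∀ g : Gal(L/K), ∀ x ∈ M, g x ∈ M)
    (g : Gal(L/K)) {x : L} (hx : x ∈ (Algebra.traceForm K L).orthogonal M) :
    g x ∈ (Algebra.traceForm K L).orthogonal M := by
  rw [LinearMap.BilinForm.mem_orthogonal_iff] at hx ⊢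
  intro y hy
  have h := hx (g.symm y) (hM _ _ hy)
  change Algebra.trace K L (g.symm y * x) = 0 at h
  change Algebra.trace K L (y * g x) = 0
  rw [← h, ← Algebra.trace_eq_of_algEquiv g (g.symm y * x), map_mul g, AlgEquiv.apply_symm_apply]

theorem span_conjugates_stable (x : L) (g : Gal(L/K)) {y : L}
    (hy : y ∈ Submodule.span K (Set.range fun σ : Gal(L/K) => σ x)) :
    g y ∈ Submodule.span K (Set.range fun σ : Gal(L/K) => σ x) := by
  induction hy using Submodule.span_induction with
  | mem z hz =>
    obtain ⟨σ, rfl⟩ := hz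
    exact Submodule.subset_span ⟨g * σ, rfl⟩
  | zero => simp
  | add a b _ _ ha hb => rw [map_add]; exact add_mem ha hb
  | smul c a _ ha => rw [map_smul]; exact Submodule.smul_mem _ c ha

theorem isNormalElement_of_span_eq_top [FiniteDimensional K L] [IsGalois K L] {x : L}
    (h : Submodule.span K (Set.range fun σ : Gal(L/K) => σ x) = ⊤) : IsNormalElement K x := by
  have : Fintype Gal(L/K) := Fintype.ofFinite _
  refine ⟨linearIndependent_of_top_le_span_of_card_eq_finrank h.ge ?_, h⟩
  rw [← Nat.card_eq_fintype_card, IsGalois.card_aut_eq_finrank]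

/-- If every non-zero stable subspace contains an element that is not trace-orthogonal to `x`, then
`x` is normal. -/
theorem isNormalElement_of_trace_ne_zero [FiniteDimensional K L] [IsGalois K L] {x : L}
    (P : L → Prop)
    (hP : ∀ y, y ≠ 0 → P y → Algebra.trace K L (x * y) ≠ 0)
    (hM : ∀ M : Submodule K L, (∀ g : Gal(L/K), ∀ y ∈ M, g y ∈ M) → M ≠ ⊥ →
      ∃ y ∈ M, y ≠ 0 ∧ P y) : IsNormalElement K x := by
  apply isNormalElement_of_span_eq_top
  set V := Submodule.span K (Set.range fun σ : Gal(L/K) => σ x) with hV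
  have hbot : (Algebra.traceForm K L).orthogonal V = ⊥ := by
    by_contra hne
    obtain ⟨y, hy, hy0, hPy⟩ := hM _ (fun g y hy =>
      orthogonal_traceForm_stable (span_conjugates_stable x) g hy) hne
    exact hP y hy0 hPy ((LinearMap.BilinForm.mem_orthogonal_iff.1 hy) x
      (Submodule.subset_span ⟨1, rfl⟩))
  have h := LinearMap.BilinForm.finrank_orthogonal (traceForm_nondegenerate K L) V
  rw [hbot, finrank_bot] at h
  exact Submodule.eq_top_of_finrank_eq (le_antisymm (Submodule.finrank_le V) (by omega))

end NormalBasis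

/-! ### The different, the critical class and the counting argument. -/

section Different

variable {K L : Type*} [Field K] [Field L] [Algebra K L] [FiniteDimensional K L]
  {v : Valuation K ℤᵐ⁰} {w : Valuation L ℤᵐ⁰} [v.HasExtension w]

theorem exists_isValuationIndependent_basis (hw : Function.Surjective w)
    (hram : IsTotallyRamified K w) :
    ∃ (π : L) (b : Module.Basis (Fin (Module.finrank K L)) K L), π ≠ 0 ∧ normOrd w π = 1 ∧
      (∀ i, b i = π ^ (i : ℕ)) ∧ IsValuationIndependent K w b := by
  obtain ⟨π, hπ0, hπ⟩ := exists_uniformizer hw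
  have hind := isValuationIndependent_of_normOrd hw hram hπ hπ0
  exact ⟨π, powBasis rfl hπ0 hind, hπ0, hπ, fun i => by simp, by rw [coe_powBasis]; exact hind⟩

/-- The residue fields agree in a totally ramified extension. -/
theorem exists_val_sub_lt_one (hw : Function.Surjective w) (hram : IsTotallyRamified K w) {t : L}
    (ht : w t = 1) : ∃ a : K, w (algebraMap K L a) = 1 ∧ w (t - algebraMap K L a) < 1 := by
  obtain ⟨π, b, hπ0, hπ, hbπ, hb⟩ := exists_isValuationIndependent_basis (K := K) hw hram
  have ht0 : t ≠ 0 := by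
    rintro rfl
    simp at ht
  obtain ⟨i, hi, hdom, hti⟩ := hb.exists_dominant ht0
  have hi' : algebraMap K L (b.repr t i) ≠ 0 := by simpa using hi
  have hpi := pow_ne_zero (i : ℕ) hπ0
  -- Order zero forces the dominant exponent to be divisible by the degree, hence to vanish; `a` is
  -- then the constant coordinate.
  have hi0 : (i : ℕ) = 0 := by
    have h := hti
    rw [hbπ, Algebra.smul_def, val_eq_iff hw ht0 (mul_ne_zero hi' hpi), normOrd_mul hw hi' hpi,
      normOrd_pow hw hπ0, hπ, mul_one, (normOrd_eq_iff hw ht0 (n := 0)).2 (by simpa using ht)] at h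
    have h1 := (exists_normOrd_algebraMap_iff hw hram).1 ⟨_, hi, rfl⟩
    have h2 : (Module.finrank K L : ℤ) ∣ (i : ℕ) := by
      rw [show ((i : ℕ) : ℤ) = -normOrd w (algebraMap K L (b.repr t i)) by linarith]
      exact (dvd_neg).2 h1
    exact Nat.eq_zero_of_dvd_of_lt (Int.natCast_dvd_natCast.1 h2) i.2
  have hbi : b i = 1 := by rw [hbπ, hi0, pow_zero]
  rw [hbi, Algebra.smul_def, mul_one] at hti
  refine ⟨b.repr t i, by rw [← hti, ht], ?_⟩
  by_cases hz : t - algebraMap K L (b.repr t i) = 0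
  · rw [hz, map_zero]; exact zero_lt_one
  obtain ⟨j, hj, -, hzj⟩ := hb.exists_dominant hz
  have hrep : ∀ j, b.repr (t - algebraMap K L (b.repr t i)) j =
      b.repr t j - if i = j then b.repr t i else 0 := by
    intro j
    have : algebraMap K L (b.repr t i) = b.repr t i • b i := by
      rw [hbi, Algebra.smul_def, mul_one]
    rw [this]
    simp [Finsupp.single_apply]
  have hji : j ≠ i := by
    rintro rfl
    exact hj (by rw [hrep]; simp)
  rw [hzj, hrep, if_neg hji.symm, sub_zero, ← ht]
  refine (hdom j hji).trans_eq ?_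
  rw [hbi, Algebra.smul_def, mul_one, hti]

/-- Together with the lower bound that follows, this makes the infimum in `differentValuation`
attained, not a default value. -/
theorem trace_integral_set_nonempty (v : Valuation K ℤᵐ⁰) [v.HasExtension w]
    (hw : Function.Surjective w) (hram : IsTotallyRamified K w) :
    {i : ℤ | ∀ x : L, x ≠ 0 → i ≤ normOrd w x → v (Algebra.trace K L x) ≤ 1}.Nonempty := by
  obtain ⟨π, b, hπ0, hπ, hbπ, hb⟩ := exists_isValuationIndependent_basis (K := K) hw hram
  obtain ⟨C, hC⟩ := (Set.finite_range fun i =>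
    WithZero.log (w (algebraMap K L (Algebra.trace K L (b i))))).bddAbove
  have hC' : ∀ i, w (algebraMap K L (Algebra.trace K L (b i))) ≤ WithZero.exp C := fun i =>
    WithZero.le_exp_log.trans (WithZero.exp_le_exp.2 (hC ⟨i, rfl⟩))
  -- `C` bounds the logarithms of the traces of the basis. From order `[L:K] + C` on, every
  -- coordinate has value at most `exp (-C)`, since the exponents of `π` stay below `[L:K]`.
  refine ⟨Module.finrank K L + C, fun x hx hxi => ?_⟩
  rw [← Valuation.HasExtension.val_map_le_one_iff v w]
  conv_lhs => rw [← b.sum_repr x, map_sum, map_sum]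
  refine w.map_sum_le fun i _ => ?_
  rw [map_smul, smul_eq_mul, map_mul, map_mul]
  have h1 := hb.repr_le x i
  rw [Algebra.smul_def, map_mul, hbπ, map_pow, val_eq_exp hw hπ0, hπ, val_eq_exp hw hx,
    ← WithZero.exp_nsmul] at h1
  have h2 : w (algebraMap K L (b.repr x i)) ≤ WithZero.exp (-C) := by
    have h3 := mul_le_mul_left h1 (WithZero.exp ((i : ℕ) : ℤ))
    rw [mul_assoc, ← WithZero.exp_add, ← WithZero.exp_add] at h3
    simp only [smul_neg, nsmul_eq_mul, mul_one, neg_add_cancel, WithZero.exp_zero] at h3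
    refine h3.trans (WithZero.exp_le_exp.2 ?_)
    have := i.2
    omega
  refine (mul_le_mul' h2 (hC' i)).trans ?_
  rw [← WithZero.exp_add, neg_add_cancel, WithZero.exp_zero]

/-- By separability some `z` has trace `1`. Multiplying it by a scalar of order `-[L:K]` makes the
trace non-integral, which bounds the admissible exponents. -/
theorem trace_integral_set_bddBelow [Algebra.IsSeparable K L] (v : Valuation K ℤᵐ⁰)
    [v.HasExtension w] (hw : Function.Surjective w) (hram : IsTotallyRamified K w) :
    BddBelow {i : ℤ | ∀ x : L, x ≠ 0 → i ≤ normOrd w x → v (Algebra.trace K L x) ≤ 1} := by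
  obtain ⟨z, hz⟩ := Algebra.trace_surjective K L 1
  have hz0 : z ≠ 0 := by
    rintro rfl
    simp at hz
  obtain ⟨t, ht0, ht⟩ := (exists_normOrd_algebraMap_iff hw hram).2
    (dvd_neg.2 (dvd_refl (Module.finrank K L : ℤ)))
  refine ⟨normOrd w z - Module.finrank K L, fun i hi => ?_⟩
  by_contra! hlt
  have ht' : algebraMap K L t ≠ 0 := by simpa using ht0
  have := hi (algebraMap K L t * z) (mul_ne_zero ht' hz0) (by
    rw [normOrd_mul hw ht' hz0, ht]; omega)
  rw [← Algebra.smul_def, map_smul, hz, smul_eq_mul, mul_one,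
    ← Valuation.HasExtension.val_map_le_one_iff v w, val_le_one_iff hw ht', ht] at this
  have h : 0 < Module.finrank K L := Module.finrank_pos
  omega

theorem val_trace_le_one [Algebra.IsSeparable K L] (v : Valuation K ℤᵐ⁰) [v.HasExtension w]
    (hw : Function.Surjective w) (hram : IsTotallyRamified K w) {x : L}
    (hx : x = 0 ∨ -differentValuation v w ≤ normOrd w x) :
    w (algebraMap K L (Algebra.trace K L x)) ≤ 1 := by
  by_cases hx0 : x = 0
  · simp [hx0]
  rw [Valuation.HasExtension.val_map_le_one_iff v w]
  have h := Int.csInf_mem (trace_integral_set_nonempty v hw hram)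
    (trace_integral_set_bddBelow v hw hram)
  refine h x hx0 ?_
  simpa [differentValuation, hx0] using hx

/-- Minimality gives one element of order `-d - 1` with non-integral trace. As the residue fields
agree, any other element of that order is a unit of `K` times it, up to elements of order at least
`-d`, whose trace is integral. -/
theorem one_lt_val_trace [Algebra.IsSeparable K L] (v : Valuation K ℤᵐ⁰) [v.HasExtension w]
    (hw : Function.Surjective w) (hram : IsTotallyRamified K w) {z : L} (hz0 : z ≠ 0)
    (hz : normOrd w z = -differentValuation v w - 1) :
    1 < w (algebraMap K L (Algebra.trace K L z)) := by
  have hnot : -differentValuation v w - 1 ∉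
      {i : ℤ | ∀ x : L, x ≠ 0 → i ≤ normOrd w x → v (Algebra.trace K L x) ≤ 1} := by
    intro hmem
    have := csInf_le (trace_integral_set_bddBelow v hw hram) hmem
    rw [differentValuation] at this
    omega
  simp only [Set.mem_ofPred_eq] at hnot
  push Not at hnot
  obtain ⟨x, hx0, hx, hTx⟩ := hnot
  have hTx' : ¬ w (algebraMap K L (Algebra.trace K L x)) ≤ 1 := by
    rw [Valuation.HasExtension.val_map_le_one_iff v w, not_le]
    exact hTx
  have hxz : normOrd w x = normOrd w z := by
    by_contra hne
    exact hTx' (val_trace_le_one v hw hram (Or.inr (by omega)))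
  obtain ⟨a, ha, hlt⟩ := exists_val_sub_lt_one hw hram (t := x / z) (by
    rw [map_div₀, (val_eq_iff hw hx0 hz0).2 hxz, div_self ((w.ne_zero_iff).2 hz0)])
  by_contra! hle
  apply hTx'
  have hsplit : x = a • z + z * (x / z - algebraMap K L a) := by
    rw [Algebra.smul_def]
    field_simp
    ring
  rw [hsplit, map_add, map_add]
  refine w.map_add_le ?_ (val_trace_le_one v hw hram ?_)
  · rw [map_smul, smul_eq_mul, map_mul, map_mul, ha, one_mul]
    exact hle
  · by_cases h0 : x / z - algebraMap K L a = 0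
    · left; rw [h0, mul_zero]
    · right
      rw [normOrd_mul hw hz0 h0]
      rw [← map_one w, val_lt_iff hw h0 one_ne_zero,
        (normOrd_eq_iff hw one_ne_zero (n := 0)).2 (by simp)] at hlt
      omega

/-- Elements with the critical residue class of the order have non-zero trace, and their trace
has the largest value relative to multiplication by small powers of a uniformizer. -/
theorem val_trace_mul_pow_le [Algebra.IsSeparable K L] (v : Valuation K ℤᵐ⁰) [v.HasExtension w]
    (hw : Function.Surjective w) (hram : IsTotallyRamified K w) {z : L} (hz0 : z ≠ 0)
    (hz : normOrd w z ≡ -differentValuation v w - 1 [ZMOD (Module.finrank K L : ℤ)]) :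
    Algebra.trace K L z ≠ 0 ∧ ∀ π : L, π ≠ 0 → normOrd w π = 1 → ∀ i < Module.finrank K L,
      w (algebraMap K L (Algebra.trace K L (z * π ^ i))) ≤
        w (algebraMap K L (Algebra.trace K L z)) * w (π ^ i) := by
  obtain ⟨k, hk0, hk⟩ := (exists_normOrd_algebraMap_iff hw hram).2 hz.dvd
  have hk' : algebraMap K L k ≠ 0 := by simpa using hk0
  have hkz : normOrd w (k • z) = -differentValuation v w - 1 := by
    rw [Algebra.smul_def, normOrd_mul hw hk' hz0, hk]; ring
  have hT := one_lt_val_trace v hw hram (smul_ne_zero hk0 hz0) hkz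
  have hTne : Algebra.trace K L (k • z) ≠ 0 := by
    intro h
    rw [h, map_zero, map_zero] at hT
    exact not_lt_zero hT
  refine ⟨fun h => hTne (by rw [map_smul, h, smul_zero]), fun π hπ0 hπ i hi => ?_⟩
  rcases Nat.eq_zero_or_pos i with rfl | hipos
  · simp
  have hpi := pow_ne_zero i hπ0
  have hle := val_trace_le_one v hw hram (x := (k • z) * π ^ i) (Or.inr (by
    rw [normOrd_mul hw (smul_ne_zero hk0 hz0) hpi, normOrd_pow hw hπ0, hπ, hkz]; omega))
  have hTne' : algebraMap K L (Algebra.trace K L (k • z)) ≠ 0 := by simpa using hTne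
  -- The order of the trace is negative and divisible by `[L:K]`, hence at most `-[L:K]`, which
  -- outweighs `i < [L:K]`.
  have h1 : (1 : ℤᵐ⁰) ≤ w (algebraMap K L (Algebra.trace K L (k • z))) * w (π ^ i) := by
    have hdvd := (exists_normOrd_algebraMap_iff hw hram).1 ⟨_, hTne, rfl⟩
    have hneg : normOrd w (algebraMap K L (Algebra.trace K L (k • z))) < 0 := by
      by_contra! h0
      exact absurd ((val_le_one_iff hw hTne').2 h0) (not_le.2 hT)
    have hneg' := Int.le_of_dvd (neg_pos.2 hneg) ((dvd_neg).2 hdvd)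
    rw [val_eq_exp hw hTne', val_eq_exp hw hpi, normOrd_pow hw hπ0, hπ, ← WithZero.exp_add,
      ← WithZero.exp_zero, WithZero.exp_le_exp]
    omega
  have h2 := hle.trans h1
  simp only [smul_mul_assoc, map_smul (Algebra.trace K L), smul_eq_mul, map_mul (algebraMap K L),
    map_mul w, mul_assoc] at h2
  exact le_of_mul_le_mul_left h2 (zero_lt_iff.2 ((w.ne_zero_iff).2 hk'))

/-- Under the valuation criterion every non-zero stable subspace contains an element whose order
is a multiple of the degree. -/
theorem exists_dvd_normOrd_of_valuationCriterion [IsGalois K L] (hw : Function.Surjective w)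
    (hram : IsTotallyRamified K w) (hVC : ValuationCriterion v w)
    {M : Submodule K L} (hM : ∀ g : Gal(L/K), ∀ x ∈ M, g x ∈ M) (hM0 : M ≠ ⊥) :
    ∃ y ∈ M, y ≠ 0 ∧ (Module.finrank K L : ℤ) ∣ normOrd w y := by
  have : NeZero (Module.finrank K L) := ⟨Module.finrank_pos.ne'⟩
  by_contra! hcon
  set N := (Algebra.traceForm K L).orthogonal M with hN
  set δ : ℤ := -differentValuation v w - 1 with hδ
  let SM := {c : ZMod (Module.finrank K L) | ∃ x ∈ M, x ≠ 0 ∧ (normOrd w x : ZMod _) = c}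
  let SN := {c : ZMod (Module.finrank K L) | ∃ x ∈ N, x ≠ 0 ∧ (normOrd w x : ZMod _) = c}
  have hM1 : Module.finrank K M ≤ SM.ncard := finrank_le_ncard_normOrd hw hram M
  have hN1 : Module.finrank K N ≤ SN.ncard := finrank_le_ncard_normOrd hw hram N
  have hMN : Module.finrank K N = Module.finrank K L - Module.finrank K M :=
    LinearMap.BilinForm.finrank_orthogonal (traceForm_nondegenerate K L) M
  have hMle := Submodule.finrank_le M
  have himg : ((fun c => (δ : ZMod (Module.finrank K L)) - c) '' SM).ncard = SM.ncard :=
    Set.ncard_image_of_injective _ sub_right_injective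
  -- If `x` in `M` and `y` in the orthogonal had orders adding up to `δ`, then `x * y` would have
  -- non-zero trace.
  have hdisj : Disjoint ((fun c => (δ : ZMod (Module.finrank K L)) - c) '' SM) SN := by
    rw [Set.disjoint_left]
    rintro _ ⟨_, ⟨x, hx, hx0, rfl⟩, rfl⟩ ⟨y, hy, hy0, hxy⟩
    refine (val_trace_mul_pow_le v hw hram (mul_ne_zero hx0 hy0) ?_).1
      ((LinearMap.BilinForm.mem_orthogonal_iff.1 hy) x hx)
    rw [← ZMod.intCast_eq_intCast_iff, normOrd_mul hw hx0 hy0, Int.cast_add, hxy]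
    ring
  have huniv : ((fun c => (δ : ZMod (Module.finrank K L)) - c) '' SM) ∪ SN = Set.univ := by
    refine Set.eq_of_subset_of_ncard_le (Set.subset_univ _) ?_ (Set.toFinite _)
    rw [Set.ncard_univ, Set.ncard_union_eq hdisj, himg, Nat.card_zmod]
    omega
  -- Either `δ = δ - c` with `c = 0` a class of `M`, or the orthogonal contains a critical element.
  -- The latter is normal, so the stable orthogonal is all of `L` and `M = 0`.
  rcases huniv.ge (Set.mem_univ (δ : ZMod (Module.finrank K L))) with ⟨c, ⟨x, hx, hx0, hc⟩, hc'⟩ | h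
  · simp only [sub_eq_self] at hc'
    rw [hc', ZMod.intCast_zmod_eq_zero_iff_dvd] at hc
    exact hcon x hx hx0 hc
  · obtain ⟨x, hx, hx0, hxδ⟩ := h
    have hnormal := hVC x hx0 (by
      rw [show ramificationIndex K w = _ from hram, ← ZMod.intCast_eq_intCast_iff, hxδ])
    have htop : N = ⊤ := by
      rw [eq_top_iff, ← hnormal.2, Submodule.span_le]
      rintro _ ⟨σ, rfl⟩
      exact orthogonal_traceForm_stable hM σ hx
    rw [htop, finrank_top] at hMN
    have hpos : 0 < Module.finrank K L := Module.finrank_pos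
    exact hM0 (Submodule.finrank_eq_zero.1 (by omega))

end Different

/-! ### Value groups and the Kummer condition. -/

section ValueSubgroup

variable {E : Type*} [Field E] (u : Valuation E ℤᵐ⁰)

theorem mem_valueSubgroup_iff_dvd {s : ℤ} :
    s ∈ valueSubgroup u ↔ ((valueSubgroup u).index : ℤ) ∣ s := by
  obtain ⟨a, ha⟩ := Int.subgroup_cyclic (valueSubgroup u)
  rw [← AddSubgroup.zmultiples_eq_closure] at ha
  rw [ha, Int.index_zmultiples, Int.natAbs_dvd, Int.mem_zmultiples_iff]

variable {u}

theorem log_mem_valueSubgroup {x : E} (hx : x ≠ 0) : WithZero.log (u x) ∈ valueSubgroup u :=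
  ⟨x, (WithZero.exp_log ((u.ne_zero_iff).2 hx)).symm⟩

theorem dvd_normOrd_iff {r s : ℤ} (hr : r ≠ 0) {a : E} (ha : a ≠ 0)
    (hs : WithZero.log (u a) = r * s) : r ∣ normOrd u a ↔ s ∈ valueSubgroup u := by
  have hmem := (mem_valueSubgroup_iff_dvd u).1 (log_mem_valueSubgroup (u := u) ha)
  rw [mem_valueSubgroup_iff_dvd, normOrd]
  -- Index `0` is the trivial value group: `normOrd` is then a division by zero, equal to `0`, and
  -- both sides hold.
  rcases eq_or_ne ((valueSubgroup u).index : ℤ) 0 with h0 | h0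
  · rw [h0] at hmem ⊢
    rw [zero_dvd_iff, hs] at hmem
    simp [(mul_eq_zero.1 hmem).resolve_left hr]
  · obtain ⟨t, ht⟩ := hmem
    rw [ht, ← mul_neg, Int.mul_ediv_cancel_left _ h0, dvd_neg]
    rw [ht] at hs
    constructor
    · rintro ⟨q, rfl⟩
      refine ⟨q, mul_left_cancel₀ hr ?_⟩
      rw [← hs]; ring
    · rintro ⟨q, rfl⟩
      refine ⟨q, mul_left_cancel₀ h0 ?_⟩
      rw [hs]; ring

end ValueSubgroup

section Kummer

variable {K L : Type*} [Field K] [Field L] [Algebra K L] {w : Valuation L ℤᵐ⁰}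

theorem card_rootsOfUnity_dvd (K : Type*) [Field K] (m : ℕ) [NeZero m] :
    Nat.card (rootsOfUnity m K) ∣ m := by
  obtain ⟨γ, hγ⟩ := IsCyclic.exists_generator (α := rootsOfUnity m K)
  rw [← orderOf_eq_card_of_forall_mem_zpowers hγ]
  refine orderOf_dvd_of_pow_eq_one ?_
  ext
  simpa using congrArg Units.val γ.2

theorem exists_isPrimitiveRoot_card (K : Type*) [Field K] (m : ℕ) [NeZero m] :
    ∃ ζ : K, IsPrimitiveRoot ζ (Nat.card (rootsOfUnity m K)) := by
  obtain ⟨γ, hγ⟩ := IsCyclic.exists_generator (α := rootsOfUnity m K)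
  rw [← orderOf_eq_card_of_forall_mem_zpowers hγ, ← Subgroup.orderOf_coe, ← orderOf_units]
  exact ⟨_, IsPrimitiveRoot.orderOf _⟩

theorem pow_card_rootsOfUnity_eq_one {m : ℕ} [NeZero m] {c : K} (hc : c ^ m = 1) :
    c ^ Nat.card (rootsOfUnity m K) = 1 := by
  have h := pow_card_eq_one' (x := rootsOfUnity.mkOfPowEq c hc)
  simpa using congrArg (fun x : rootsOfUnity m K => ((x : Kˣ) : K)) h

/-- Under the valuation criterion, the cyclic subextensions of degree `r` are unit root Kummer
extensions. -/
theorem isUnitRootKummer_of_valuationCriterion [FiniteDimensional K L] [IsAbelianGalois K L]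
    {v : Valuation K ℤᵐ⁰} [v.HasExtension w] (hw : Function.Surjective w)
    (hram : IsTotallyRamified K w) (hVC : ValuationCriterion v w) {m : ℕ} [NeZero m]
    (E : IntermediateField K L) (F : IntermediateField E L) [IsGalois E F] [IsCyclic Gal(F/E)]
    (hr : Module.finrank E F = Nat.card (rootsOfUnity m K)) :
    IsUnitRootKummer (w.comap (algebraMap E L)) F := by
  have hr0 : Nat.card (rootsOfUnity m K) ≠ 0 := Nat.card_pos.ne'
  set r := Nat.card (rootsOfUnity m K) with hrdef
  obtain ⟨ζ, hζ⟩ := exists_isPrimitiveRoot_card K m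
  refine ⟨inferInstance, .of_isCyclic E F, r, ⟨algebraMap K E ζ,
    hζ.map_of_injective (algebraMap K E).injective⟩, ?_, ?_⟩
  · rw [IsCyclic.exponent_eq_card, IsGalois.card_aut_eq_finrank, hr]
  rintro a ha ⟨y, hy⟩
  have hyL : (y : L) ^ r = algebraMap E L a := congrArg (algebraMap F L) hy
  have haL : algebraMap E L a ≠ 0 := by simpa using ha
  have hy0 : (y : L) ≠ 0 := by
    intro h0
    rw [h0, zero_pow hr0] at hyL
    exact haL hyL.symm
  have hS : ∀ h ∈ E.fixingSubgroup, ∃ c : K, h (y : L) = algebraMap K L c * y := by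
    intro h hh
    have hpow : (h (y : L) / y) ^ r = 1 := by
      rw [div_pow, ← map_pow, hyL]
      rw [show h (algebraMap E L a) = algebraMap E L a from
        (IntermediateField.mem_fixingSubgroup_iff E h).1 hh _ a.2, div_self haL]
    have : NeZero r := ⟨hr0⟩
    obtain ⟨i, -, hi⟩ := (hζ.map_of_injective (algebraMap K L).injective).eq_pow_of_pow_eq_one hpow
    refine ⟨ζ ^ i, ?_⟩
    rw [map_pow, hi, div_mul_cancel₀ _ hy0]
  obtain ⟨z, hz, hz0, hzn⟩ := exists_dvd_normOrd_of_valuationCriterion hw hram hVC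
    (M := fixedFieldLine E.fixingSubgroup (y : L))
    (fun g x hx => fixedFieldLine_stable hy0 hS g hx)
    ((Submodule.ne_bot_iff _).2 ⟨y, mem_fixedFieldLine.2 ⟨1, one_mem _, one_mul _⟩, hy0⟩)
  obtain ⟨e, he, rfl⟩ := mem_fixedFieldLine.1 hz
  rw [IsGalois.fixedField_fixingSubgroup] at he
  -- The element `e * y` has the value of some `k` in `K`, so the value of `y` is that of `k / e`,
  -- which lies in `E`.
  have he0 : e ≠ 0 := left_ne_zero_of_mul hz0
  obtain ⟨k, hk0, hk⟩ := (exists_normOrd_algebraMap_iff hw hram).2 hzn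
  have hk' : algebraMap K L k ≠ 0 := by simpa using hk0
  rw [dvd_normOrd_iff (s := WithZero.log (w y)) (by exact_mod_cast hr0) ha]
  · have h1 := log_mem_valueSubgroup (u := w.comap (algebraMap E L)) (x := ⟨e, he⟩)
      (by simpa [Subtype.ext_iff] using he0)
    have h2 := log_mem_valueSubgroup (u := w.comap (algebraMap E L)) (x := algebraMap K E k)
      (by simpa using hk0)
    have h3 := sub_mem h2 h1
    convert h3 using 1
    have h4 := (val_eq_iff hw hk' hz0).2 hk
    simp only [Valuation.comap_apply, ← IsScalarTower.algebraMap_apply]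
    rw [h4, map_mul, WithZero.log_mul ((w.ne_zero_iff).2 he0) ((w.ne_zero_iff).2 hy0)]
    exact (add_sub_cancel_left _ _).symm
  · rw [Valuation.comap_apply, ← hyL, map_pow, WithZero.log_pow, nsmul_eq_mul]

/-- If an eigenvector has a scalar that generates the roots of unity and the cyclic subextensions
of degree `r` are unit root Kummer, then the value of the eigenvector is attained on the fixed field
of its scalar stabilizer. -/
theorem exists_val_eq_of_isUnitRootKummer [FiniteDimensional K L] [IsAbelianGalois K L] {m : ℕ}
    [NeZero m] (hexp : Monoid.exponent Gal(L/K) = m)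
    (hK : ∀ (E : IntermediateField K L) (F : IntermediateField E L),
      IsGalois E F → IsCyclic Gal(F/E) → Module.finrank E F = Nat.card (rootsOfUnity m K) →
        IsUnitRootKummer (w.comap (algebraMap E L)) F)
    {y : L} (hy0 : y ≠ 0) {h : Gal(L/K)} {ζ : K}
    (hζ : IsPrimitiveRoot ζ (Nat.card (rootsOfUnity m K))) (hh : h y = algebraMap K L ζ * y) :
    ∃ e ∈ IntermediateField.fixedField (scalarStabilizer K y), e ≠ 0 ∧ w e = w y := by
  set r := Nat.card (rootsOfUnity m K) with hrdef
  have hr0 : r ≠ 0 := Nat.card_pos.ne'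
  set S := scalarStabilizer K y with hSdef
  set E := IntermediateField.fixedField S with hE
  have hyr : y ^ r ∈ E := by
    rw [hE, mem_fixedField]
    rintro g ⟨c, hc⟩
    have hcm : c ^ m = 1 := by
      have h := pow_apply_of_apply_eq hc m
      rw [← hexp, Monoid.pow_exponent_eq_one, AlgEquiv.one_apply, hexp] at h
      have h' := mul_right_cancel₀ hy0 ((one_mul y).trans h)
      rw [← map_one (algebraMap K L)] at h'
      exact ((algebraMap K L).injective h').symm
    rw [map_pow, hc, mul_pow, ← map_pow, pow_card_rootsOfUnity_eq_one hcm, map_one, one_mul]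
  set a : E := ⟨y ^ r, hyr⟩ with ha
  have ha0 : a ≠ 0 := by
    rw [ne_eq, Subtype.ext_iff]
    exact pow_ne_zero r hy0
  set F : IntermediateField E L := IntermediateField.adjoin E {y} with hF
  have hyint : IsIntegral E y := Algebra.IsIntegral.isIntegral y
  have hfin : Module.finrank E F ≤ r := by
    rw [hF, IntermediateField.adjoin.finrank hyint, ← natDegree_X_pow_sub_C (n := r) (r := a)]
    refine natDegree_le_of_dvd (minpoly.dvd E y ?_) (X_pow_sub_C_ne_zero (Nat.pos_of_ne_zero hr0) a)
    rw [map_sub, map_pow, aeval_X, aeval_C]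
    exact sub_self _
  have hyF : y ∈ F := IntermediateField.mem_adjoin_simple_self E y
  have hmem : h ∈ E.fixingSubgroup := by
    rw [IntermediateField.mem_fixingSubgroup_iff]
    intro x hx
    exact mem_fixedField.1 hx h ⟨ζ, hh⟩
  let h' : Gal(L/E) := IntermediateField.fixingSubgroupEquiv E ⟨h, hmem⟩
  have hh' : ∀ x, h' x = h x := fun x => rfl
  let σ : Gal(F/E) := h'.restrictNormal F
  have hσ : ∀ i : ℕ, algebraMap F L ((σ ^ i) ⟨y, hyF⟩) = algebraMap K L (ζ ^ i) * y := by
    intro i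
    induction i with
    | zero => simp
    | succ i IH =>
      rw [pow_succ', AlgEquiv.mul_apply, AlgEquiv.restrictNormal_commutes, IH, hh', map_mul,
        AlgEquiv.commutes, hh, pow_succ, map_mul, mul_assoc]
  -- Since `σ` multiplies `y` by a primitive `r`-th root of unity and `[F:E] ≤ r`, it generates a
  -- Galois group of order exactly `r`.
  have hord : r ∣ orderOf σ := by
    apply hζ.dvd_of_pow_eq_one
    have h1 := hσ (orderOf σ)
    rw [pow_orderOf_eq_one, AlgEquiv.one_apply] at h1
    have h2 := mul_right_cancel₀ hy0 ((one_mul y).trans h1)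
    rw [← map_one (algebraMap K L)] at h2
    exact ((algebraMap K L).injective h2).symm
  have hcard : Nat.card Gal(F/E) = Module.finrank E F := IsGalois.card_aut_eq_finrank E F
  have hle : r ≤ orderOf σ := Nat.le_of_dvd (orderOf_pos σ) hord
  have hle' : orderOf σ ≤ Nat.card Gal(F/E) := orderOf_le_card
  have hcyc : IsCyclic Gal(F/E) := isCyclic_of_orderOf_eq_card σ (by omega)
  obtain ⟨-, -, m', -, hm', hW⟩ := hK E F inferInstance hcyc (by omega)
  rw [IsCyclic.exponent_eq_card, hcard, le_antisymm hfin (by omega)] at hm'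
  subst hm'
  have hdvd := hW a ha0 ⟨⟨y, hyF⟩, rfl⟩
  rw [dvd_normOrd_iff (s := WithZero.log (w y)) (by exact_mod_cast hr0) ha0 (by
    rw [Valuation.comap_apply]
    change WithZero.log (w (y ^ r)) = _
    rw [map_pow, WithZero.log_pow, nsmul_eq_mul])] at hdvd
  obtain ⟨e, he⟩ := hdvd
  rw [Valuation.comap_apply, WithZero.exp_log ((w.ne_zero_iff).2 hy0)] at he
  refine ⟨algebraMap E L e, e.2, ?_, he⟩
  rintro h0
  rw [h0, map_zero, eq_comm, map_eq_zero] at he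
  exact hy0 he

/-- Characters of the Galois group with values in the base field have eigenvectors. -/
theorem exists_eigenvector_of_character [FiniteDimensional K L] (χ : Gal(L/K) →* Kˣ) :
    ∃ z : L, z ≠ 0 ∧ ∀ g, g z = algebraMap K L (χ g) * z := by
  -- Hilbert 90: a character with values in `K` is a 1-cocycle.
  obtain ⟨β, hβ⟩ := groupCohomology.isMulCoboundary₁_of_isMulCocycle₁_of_aut_to_units
    (fun g => Units.map (algebraMap K L).toMonoidHom (χ g)) (by
      intro g h
      ext
      simp [mul_comm])
  refine ⟨β, β.ne_zero, fun g => ?_⟩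
  have := congrArg Units.val (div_eq_iff_eq_mul.1 (hβ g))
  simpa using this

/-- An abelian extension of exponent `p ^ k` has an eigenvector with character of order the number
of `p ^ k`-th roots of unity in the base field. -/
theorem exists_eigenvector_generator [FiniteDimensional K L] [IsAbelianGalois K L] {p k : ℕ}
    [Fact p.Prime] (hexp : Monoid.exponent Gal(L/K) = p ^ k) :
    ∃ z : L, z ≠ 0 ∧ scalarStabilizer K z = ⊤ ∧ ∃ (h : Gal(L/K)) (ζ : K),
      IsPrimitiveRoot ζ (Nat.card (rootsOfUnity (p ^ k) K)) ∧ h z = algebraMap K L ζ * z := by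
  have hp : p.Prime := Fact.out
  have : NeZero (p ^ k) := ⟨pow_ne_zero _ hp.ne_zero⟩
  obtain ⟨ζ, hζ⟩ := exists_isPrimitiveRoot_card K (p ^ k)
  have hr : Nat.card (rootsOfUnity (p ^ k) K) ∣ p ^ k :=
    card_rootsOfUnity_dvd K _
  obtain ⟨l, hlk, hl⟩ := (Nat.dvd_prime_pow hp).1 hr
  rw [hl] at hζ ⊢
  let _ : CommGroup Gal(L/K) := { (inferInstance : Group Gal(L/K)) with mul_comm := gal_comm }
  suffices hχ : ∃ (χ : Gal(L/K) →* Kˣ) (h : Gal(L/K)), IsPrimitiveRoot (χ h : K) (p ^ l) by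
    obtain ⟨χ, h, hχ⟩ := hχ
    obtain ⟨z, hz0, hz⟩ := exists_eigenvector_of_character χ
    exact ⟨z, hz0, (Subgroup.eq_top_iff' _).2 fun g => ⟨_, hz g⟩, h, _, hχ, hz h⟩
  rcases Nat.eq_zero_or_pos l with rfl | hlpos
  · exact ⟨1, 1, by simp⟩
  obtain ⟨l, rfl⟩ := Nat.exists_eq_succ_of_ne_zero hlpos.ne'
  obtain ⟨g, hg⟩ := Monoid.exists_orderOf_eq_exponent
    (Monoid.ExponentExists.of_finite (G := Gal(L/K)))
  -- The quotient by `R` has exponent dividing `p ^ (l + 1)`, so its characters with values in `K`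
  -- separate points. For `g` of maximal order, `g ^ p ^ l` is not in `R`; a character non-trivial
  -- there has full order at `g`.
  let R : Subgroup Gal(L/K) := (powMonoidHom (p ^ (l + 1)) : Gal(L/K) →* Gal(L/K)).range
  have hQ : ∀ q : Gal(L/K) ⧸ R, q ^ p ^ (l + 1) = 1 := by
    intro q
    induction q using QuotientGroup.induction_on with | _ q
    rw [← QuotientGroup.mk_pow, QuotientGroup.eq_one_iff]
    exact ⟨q, rfl⟩
  have : NeZero (p ^ (l + 1)) := ⟨pow_ne_zero _ hp.ne_zero⟩
  have : HasEnoughRootsOfUnity K (p ^ (l + 1)) := ⟨⟨ζ, hζ⟩, inferInstance⟩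
  have : HasEnoughRootsOfUnity K (Monoid.exponent (Gal(L/K) ⧸ R)) :=
    .of_dvd K (Monoid.exponent_dvd_of_forall_pow_eq_one hQ)
  have hne : ((g ^ p ^ l : Gal(L/K)) : Gal(L/K) ⧸ R) ≠ 1 := by
    rw [ne_eq, QuotientGroup.eq_one_iff]
    rintro ⟨h, hh⟩
    have h1 : g ^ p ^ (k - 1) = 1 := by
      have : p ^ (k - 1) = p ^ l * p ^ (k - (l + 1)) := by
        rw [← pow_add]; congr 1; omega
      rw [this, pow_mul, ← hh, powMonoidHom_apply, ← pow_mul, ← pow_add,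
        Nat.add_sub_cancel' hlk, ← hexp, Monoid.pow_exponent_eq_one]
    rw [← orderOf_dvd_iff_pow_eq_one, hg, hexp, Nat.pow_dvd_pow_iff_le_right hp.one_lt] at h1
    omega
  obtain ⟨φ, hφ⟩ := CommGroup.exists_apply_ne_one_of_hasEnoughRootsOfUnity
    (Gal(L/K) ⧸ R) K hne
  refine ⟨φ.comp (QuotientGroup.mk' R), g, ?_⟩
  have hc := orderOf_eq_prime_pow (x := φ (g : Gal(L/K) ⧸ R)) (p := p) (n := l)
    (by rwa [← map_pow, ← QuotientGroup.mk_pow]) (by rw [← map_pow, hQ, map_one])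
  rw [← hc, ← orderOf_units]
  exact IsPrimitiveRoot.orderOf _

theorem isPrimitiveRoot_mul_of_not {p l : ℕ} [Fact p.Prime] {c ζ : K} (hc : c ^ p ^ l = 1)
    (hc' : ¬ IsPrimitiveRoot c (p ^ l)) (hζ : IsPrimitiveRoot ζ (p ^ l)) :
    IsPrimitiveRoot (c * ζ) (p ^ l) := by
  have hp : p.Prime := Fact.out
  match l with
  | 0 => exact absurd (by simpa using hc) hc'
  | l + 1 =>
    have h1 : c ^ p ^ l = 1 := by
      by_contra h
      exact hc' (orderOf_eq_prime_pow h hc ▸ IsPrimitiveRoot.orderOf c)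
    have h2 : ¬ (c * ζ) ^ p ^ l = 1 := by
      rw [mul_pow, h1, one_mul]
      intro h
      have := (Nat.pow_dvd_pow_iff_le_right hp.one_lt).1 (hζ.dvd_of_pow_eq_one _ h)
      omega
    rw [← orderOf_eq_prime_pow h2 (by rw [mul_pow, hc, hζ.pow_eq_one, one_mul])]
    exact IsPrimitiveRoot.orderOf _

/-- If the cyclic subextensions of degree `r` are unit root Kummer, every non-zero stable subspace
contains an element of value one. -/
theorem exists_val_eq_one_of_isUnitRootKummer [FiniteDimensional K L] [IsAbelianGalois K L]
    {p k : ℕ} [Fact p.Prime] (hexp : Monoid.exponent Gal(L/K) = p ^ k)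
    (hsplit : ∀ ξ : K, (X ^ p - C (ξ ^ p)).Splits)
    (h2 : p = 2 → 8 ∣ p ^ k → Nat.card (rootsOfUnity (p ^ k) K) ≠ 2)
    (hK : ∀ (E : IntermediateField K L) (F : IntermediateField E L),
      IsGalois E F → IsCyclic Gal(F/E) → Module.finrank E F = Nat.card (rootsOfUnity (p ^ k) K) →
        IsUnitRootKummer (w.comap (algebraMap E L)) F)
    {M : Submodule K L} (hM : ∀ g : Gal(L/K), ∀ x ∈ M, g x ∈ M) (hM0 : M ≠ ⊥) :
    ∃ y ∈ M, y ≠ 0 ∧ w y = 1 := by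
  have hp : p.Prime := Fact.out
  have : NeZero (p ^ k) := ⟨pow_ne_zero _ hp.ne_zero⟩
  obtain ⟨y, hy0, hline, hcase⟩ := exists_fixedFieldLine_le hexp hsplit h2 hM hM0
  suffices h : ∃ e ∈ IntermediateField.fixedField (scalarStabilizer K y), e ≠ 0 ∧ w e = w y by
    obtain ⟨e, he, he0, hey⟩ := h
    refine ⟨e⁻¹ * y, hline (mem_fixedFieldLine.2 ⟨_, inv_mem he, rfl⟩),
      mul_ne_zero (inv_ne_zero he0) hy0, ?_⟩
    rw [map_mul, map_inv₀, hey, inv_mul_cancel₀ ((w.ne_zero_iff).2 hy0)]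
  by_cases hprim : ∃ (h : Gal(L/K)) (ζ : K),
      IsPrimitiveRoot ζ (Nat.card (rootsOfUnity (p ^ k) K)) ∧ h y = algebraMap K L ζ * y
  · obtain ⟨h, ζ, hζ, hh⟩ := hprim
    exact exists_val_eq_of_isUnitRootKummer hexp hK hy0 hζ hh
  have htop := hcase.resolve_right hprim
  obtain ⟨z, hz0, hztop, h, ζ, hζ, hh⟩ := exists_eigenvector_generator (K := K) (L := L) hexp
  obtain ⟨c, hc⟩ : h ∈ scalarStabilizer K y := htop ▸ Subgroup.mem_top h
  obtain ⟨l, -, hl⟩ := (Nat.dvd_prime_pow hp).1 (card_rootsOfUnity_dvd K (p ^ k))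
  have hcr : c ^ p ^ k = 1 := by
    have h := pow_apply_of_apply_eq hc (p ^ k)
    rw [← hexp, Monoid.pow_exponent_eq_one, AlgEquiv.one_apply, hexp] at h
    have h' := mul_right_cancel₀ hy0 ((one_mul y).trans h)
    rw [← map_one (algebraMap K L)] at h'
    exact ((algebraMap K L).injective h').symm
  have hcr' := pow_card_rootsOfUnity_eq_one hcr
  -- A non-primitive root times a primitive one is primitive, so `z` and `y * z` both have full
  -- characters.
  have hcz : IsPrimitiveRoot (c * ζ) (Nat.card (rootsOfUnity (p ^ k) K)) := by
    have hnot : ¬ IsPrimitiveRoot c (Nat.card (rootsOfUnity (p ^ k) K)) :=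
      fun h' => hprim ⟨h, c, h', hc⟩
    rw [hl] at hcr' hnot hζ ⊢
    exact isPrimitiveRoot_mul_of_not hcr' hnot hζ
  obtain ⟨e₁, he₁, he₁0, hw₁⟩ := exists_val_eq_of_isUnitRootKummer hexp hK hz0 hζ hh
  obtain ⟨e₂, he₂, he₂0, hw₂⟩ := exists_val_eq_of_isUnitRootKummer hexp hK (mul_ne_zero hy0 hz0)
    hcz (h := h) (by rw [map_mul, hc, hh, map_mul]; ring)
  have hyztop : scalarStabilizer K (y * z) = ⊤ := by
    refine (Subgroup.eq_top_iff' _).2 fun g => ?_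
    obtain ⟨a, ha⟩ : g ∈ scalarStabilizer K y := htop ▸ Subgroup.mem_top g
    obtain ⟨b, hb⟩ : g ∈ scalarStabilizer K z := hztop ▸ Subgroup.mem_top g
    exact ⟨a * b, by rw [map_mul, ha, hb, map_mul]; ring⟩
  rw [htop]
  rw [hztop] at he₁
  rw [hyztop] at he₂
  refine ⟨e₂ / e₁, div_mem he₂ he₁, div_ne_zero he₂0 he₁0, ?_⟩
  rw [map_div₀, hw₁, hw₂, map_mul, mul_div_cancel_right₀ _ ((w.ne_zero_iff).2 hz0)]

end Kummer

/-! ### Extending the valuation. -/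

/-- The spectral norm of an algebraic extension of a complete discretely valued field. -/
theorem exists_spectral_valuation {K : Type*} [Field K] [Valued K ℤᵐ⁰] [CompleteSpace K]
    (hv : Function.Surjective (Valued.v : Valuation K ℤᵐ⁰)) (L' : Type*) [Field L'] [Algebra K L']
    [Algebra.IsAlgebraic K L'] :
    ∃ u : Valuation L' NNReal,
      (∀ k : K, u (algebraMap K L' k) ≤ 1 ↔ (Valued.v : Valuation K ℤᵐ⁰) k ≤ 1) ∧
      ∀ x y : L', minpoly K x = minpoly K y → u x = u y := by
  obtain ⟨t, ht⟩ := hv (WithZero.exp 1)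
  -- The base `2` is an arbitrary choice that makes the value group real.
  let _ : Valuation.RankOne (Valued.v : Valuation K ℤᵐ⁰) :=
    { hom' := (WithZeroMulInt.toNNReal (e := 2) two_ne_zero).comp
        MonoidWithZeroHom.ValueGroup₀.embedding
      strictMono' := (WithZeroMulInt.toNNReal_strictMono one_lt_two).comp
        MonoidWithZeroHom.ValueGroup₀.embedding_strictMono
      exists_val_nontrivial := ⟨t, by rw [ht]; exact WithZero.exp_ne_zero, by rw [ht]; decide⟩ }
  let _ : NontriviallyNormedField K :=
    Valued.toNontriviallyNormedField K ℤᵐ⁰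
  refine ⟨⟨⟨⟨fun x => ⟨spectralNorm K L' x, spectralNorm_nonneg x⟩, ?_⟩, ?_, ?_⟩, ?_⟩, ?_, ?_⟩
  · ext; exact spectralNorm_zero
  · ext; exact spectralNorm_one
  · intro x y; ext; exact spectralAlgNorm_mul x y
  · intro x y; exact isNonarchimedean_spectralNorm x y
  · intro k
    rw [← Valued.toNormedField.norm_le_one_iff, ← spectralNorm_extends (L := L') k]
    rfl
  · intro x y h
    ext
    exact congrArg spectralValue h

/-- A valuation of a totally ramified extension is determined by its restriction to the base. -/
theorem isEquiv_of_isTotallyRamified {K L Γ₀ : Type*} [Field K] [Field L] [Algebra K L]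
    [FiniteDimensional K L] [LinearOrderedCommGroupWithZero Γ₀] {w : Valuation L ℤᵐ⁰}
    {u : Valuation L Γ₀} (hw : Function.Surjective w) (hram : IsTotallyRamified K w)
    (hu : ∀ k : K, u (algebraMap K L k) ≤ 1 ↔ w (algebraMap K L k) ≤ 1) : w.IsEquiv u := by
  obtain ⟨π, b, hπ0, hπ, hbπ, hb⟩ := exists_isValuationIndependent_basis (K := K) hw hram
  have hpos : 0 < Module.finrank K L := Module.finrank_pos
  have hrepr : ∀ x : L, w x ≤ 1 → ∀ i, u (algebraMap K L (b.repr x i)) ≤ 1 := by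
    intro x hx i
    rw [hu]
    by_cases h0 : b.repr x i = 0
    · simp [h0]
    have h0' : algebraMap K L (b.repr x i) ≠ 0 := by simpa using h0
    have hpi := pow_ne_zero (i : ℕ) hπ0
    have h1 := (hb.repr_le x i).trans hx
    rw [Algebra.smul_def, hbπ, val_le_one_iff hw (mul_ne_zero h0' hpi), normOrd_mul hw h0' hpi,
      normOrd_pow hw hπ0, hπ] at h1
    rw [val_le_one_iff hw h0']
    by_contra! hneg
    have h2 := Int.le_of_dvd (neg_pos.2 hneg)
      ((dvd_neg).2 ((exists_normOrd_algebraMap_iff hw hram).1 ⟨_, h0, rfl⟩))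
    have := i.2
    omega
  have huπ : u π ≤ 1 := by
    by_contra! hlt
    -- `π ^ [L:K]` is a combination of lower powers with `u`-integral coefficients, so it would be
    -- too small if `u π > 1`.
    have h1 : u (π ^ Module.finrank K L) ≤ u π ^ (Module.finrank K L - 1) := by
      rw [← b.sum_repr (π ^ Module.finrank K L)]
      refine u.map_sum_le fun i _ => ?_
      rw [Algebra.smul_def, map_mul, hbπ, map_pow u]
      have h2 : u (algebraMap K L (b.repr (π ^ Module.finrank K L) i)) ≤ 1 := by
        refine hrepr _ ?_ i
        rw [val_le_one_iff hw (pow_ne_zero _ hπ0), normOrd_pow hw hπ0, hπ]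
        positivity
      refine (mul_le_of_le_one_left zero_le h2).trans (pow_le_pow_right₀ hlt.le ?_)
      have := i.2
      omega
    rw [map_pow] at h1
    exact absurd h1 (not_le.2 (pow_lt_pow_right₀ hlt (by omega)))
  have hle : ∀ x : L, w x ≤ 1 → u x ≤ 1 := by
    intro x hx
    rw [← b.sum_repr x]
    refine u.map_sum_le fun i _ => ?_
    rw [Algebra.smul_def, map_mul, hbπ, map_pow]
    exact mul_le_one' (hrepr x hx i) (pow_le_one' huπ _)
  have hlt : ∀ x : L, w x < 1 → u x < 1 := by
    intro x hx
    by_cases hx0 : x = 0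
    · rw [hx0, map_zero]; exact zero_lt_one
    obtain ⟨t, ht0, ht⟩ := (exists_normOrd_algebraMap_iff hw hram).2
      (dvd_refl (Module.finrank K L : ℤ))
    have ht' : algebraMap K L t ≠ 0 := by simpa using ht0
    have hut : u (algebraMap K L t) < 1 := by
      have h1 : ¬ u (algebraMap K L t⁻¹) ≤ 1 := by
        rw [hu, map_inv₀, val_le_one_iff hw (inv_ne_zero ht'), ← zpow_neg_one,
          normOrd_zpow hw ht', ht]
        omega
      rw [map_inv₀, map_inv₀, not_le] at h1
      exact (one_lt_inv₀ (zero_lt_iff.2 ((u.ne_zero_iff).2 ht'))).1 h1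
    have hx1 : 0 < normOrd w x := by
      rw [← map_one w, val_lt_iff hw hx0 one_ne_zero,
        (normOrd_eq_iff hw one_ne_zero (n := 0)).2 (by simp)] at hx
      exact hx
    -- Positive order of `x` makes `x ^ [L:K] / t` integral, while `t` has order `[L:K]` and `u t <
    -- 1`.
    have h2 : u (x ^ Module.finrank K L * (algebraMap K L t)⁻¹) ≤ 1 := by
      apply hle
      rw [val_le_one_iff hw (mul_ne_zero (pow_ne_zero _ hx0) (inv_ne_zero ht')),
        normOrd_mul hw (pow_ne_zero _ hx0) (inv_ne_zero ht'), normOrd_pow hw hx0,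
        ← zpow_neg_one, normOrd_zpow hw ht', ht]
      nlinarith
    rw [map_mul, map_pow, map_inv₀,
      mul_inv_le_iff₀ (zero_lt_iff.2 ((u.ne_zero_iff).2 ht')), one_mul] at h2
    by_contra! h3
    exact absurd (h2.trans_lt hut) (not_lt.2 (one_le_pow_of_one_le' h3 _))
  refine Valuation.isEquiv_of_val_le_one fun x => ⟨hle x, fun h => ?_⟩
  by_contra! h1
  have hx0 : x ≠ 0 := by
    rintro rfl
    simp at h1
  have h2 := hlt x⁻¹ (by rw [map_inv₀]; exact inv_lt_one_of_one_lt₀ h1)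
  rw [map_inv₀, inv_lt_one₀ (zero_lt_iff.2 ((u.ne_zero_iff).2 hx0))] at h2
  exact absurd h (not_le.2 h2)

/-! ### Adjoining a primitive `p`-th root of unity. -/

section Cyclotomic

/-- The minimal polynomial divides the cyclotomic polynomial, of degree `p - 1 < p`. -/
theorem finrank_adjoin_primitiveRoot_coprime {F F' : Type*} [Field F] [Field F'] [Algebra F F']
    {p : ℕ} [hp : Fact p.Prime] {ζ : F'} (hζ : IsPrimitiveRoot ζ p) :
    (Module.finrank F (IntermediateField.adjoin F {ζ})).Coprime p := by
  have hint : IsIntegral F ζ := (hζ.isIntegral hp.out.pos).tower_top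
  rw [IntermediateField.adjoin.finrank hint, Nat.coprime_comm, Nat.Prime.coprime_iff_not_dvd hp.out]
  have hdvd : minpoly F ζ ∣ cyclotomic p F := by
    refine minpoly.dvd F ζ ?_
    have := hζ.isRoot_cyclotomic hp.out.pos
    rwa [← map_cyclotomic p (algebraMap F F'), IsRoot.def, eval_map_algebraMap] at this
  have hle := natDegree_le_of_dvd hdvd (cyclotomic_ne_zero p F)
  rw [natDegree_cyclotomic, Nat.totient_prime hp.out] at hle
  intro h
  have := Nat.le_of_dvd (minpoly.natDegree_pos hint) h
  have := hp.out.two_le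
  omega

theorem not_isPrimitiveRoot_of_finrank_eq_pow {K L : Type*} [Field K] [Field L] [Algebra K L]
    [FiniteDimensional K L] {p k : ℕ} [hp : Fact p.Prime] (hdeg : Module.finrank K L = p ^ k)
    (hno : ¬ ∃ ζ : K, IsPrimitiveRoot ζ p) (ξ : L) : ¬ IsPrimitiveRoot ξ p := by
  intro hξ
  have h1 := finrank_adjoin_primitiveRoot_coprime (F := K) hξ
  have h2 : Module.finrank K (IntermediateField.adjoin K {ξ}) ∣ p ^ k := by
    rw [← hdeg]
    exact Dvd.intro _ (Module.finrank_mul_finrank K (IntermediateField.adjoin K {ξ}) L)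
  have h3 := Nat.Coprime.eq_one_of_dvd (h1.pow_right k) h2
  rw [IntermediateField.finrank_adjoin_simple_eq_one_iff, IntermediateField.mem_bot] at h3
  obtain ⟨ζ, rfl⟩ := h3
  exact hno ⟨ζ, hξ.of_map_of_injective (algebraMap K L).injective⟩

variable {K L L' : Type*} [Field K] [Field L] [Field L'] [Algebra L L'] [Algebra K L']
  {p : ℕ} [Fact p.Prime] [IsCyclotomicExtension {p} L L'] {ζ : L'}

theorem subalgebra_eq_top_of_mem (hζ : IsPrimitiveRoot ζ p) (S : Subalgebra K L')
    (hL : ∀ x : L, algebraMap L L' x ∈ S) (hS : ζ ∈ S) : S = ⊤ := by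
  have hp : p.Prime := Fact.out
  have : NeZero p := ⟨hp.ne_zero⟩
  rw [Algebra.eq_top_iff]
  intro x
  have hx := IsCyclotomicExtension.adjoin_roots (S := {p}) (A := L) x
  induction hx using Algebra.adjoin_induction with
  | mem x hx =>
    obtain ⟨n, hn, -, hx⟩ := hx
    rw [Set.mem_singleton_iff] at hn
    subst hn
    obtain ⟨i, -, rfl⟩ := hζ.eq_pow_of_pow_eq_one hx
    exact pow_mem hS i
  | algebraMap r => exact hL r
  | add x y _ _ hx hy => exact add_mem hx hy
  | mul x y _ _ hx hy => exact mul_mem hx hy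

theorem algEquiv_ext_of_eq (hζ : IsPrimitiveRoot ζ p) {σ τ : Gal(L'/K)}
    (hL : ∀ x : L, σ (algebraMap L L' x) = τ (algebraMap L L' x)) (h : σ ζ = τ ζ) : σ = τ := by
  have := subalgebra_eq_top_of_mem hζ (AlgHom.equalizer σ.toAlgHom τ.toAlgHom) hL h
  ext x
  exact (this.ge (Algebra.mem_top (R := K) (x := x)) : _)

theorem finrank_cyclotomic_coprime (hζ : IsPrimitiveRoot ζ p) :
    (Module.finrank L L').Coprime p := by
  have : NeZero p := ⟨(Fact.out : p.Prime).ne_zero⟩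
  have h : IntermediateField.adjoin L {ζ} = ⊤ := by
    rw [← IntermediateField.toSubalgebra_inj, IntermediateField.top_toSubalgebra]
    exact subalgebra_eq_top_of_mem hζ _ (fun x => IntermediateField.algebraMap_mem _ x)
      (IntermediateField.mem_adjoin_simple_self L ζ)
  rw [← IntermediateField.finrank_top', ← h]
  exact finrank_adjoin_primitiveRoot_coprime hζ

variable [Algebra K L] [IsScalarTower K L L']

/-- The field `L'` is the compositum of the normal extensions `L` and `K(ζ)` of `K`. -/
theorem isGalois_of_cyclotomic [FiniteDimensional K L] [IsGalois K L] (hζ : IsPrimitiveRoot ζ p) :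
    IsGalois K L' := by
  have : NeZero p := ⟨(Fact.out : p.Prime).ne_zero⟩
  have : FiniteDimensional L L' := IsCyclotomicExtension.finiteDimensional {p} L L'
  have : FiniteDimensional K L' := FiniteDimensional.trans K L L'
  have : IsGalois L L' := IsCyclotomicExtension.isGalois {p} L L'
  have : Algebra.IsSeparable K L' := Algebra.IsSeparable.trans K L L'
  have : IsCyclotomicExtension {p} K (IntermediateField.adjoin K {ζ}) :=
    hζ.intermediateField_adjoin_isCyclotomicExtension K
  have : IsGalois K (IntermediateField.adjoin K {ζ}) := IsCyclotomicExtension.isGalois {p} K _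
  let f : L →ₐ[K] L' := IsScalarTower.toAlgHom K L L'
  have : Normal K f.fieldRange := Normal.of_algEquiv (AlgEquiv.ofInjectiveField f)
  have htop : f.fieldRange ⊔ IntermediateField.adjoin K {ζ} = ⊤ := by
    rw [← IntermediateField.toSubalgebra_inj, IntermediateField.top_toSubalgebra]
    refine subalgebra_eq_top_of_mem (L := L) hζ _ (fun x => ?_) ?_
    · exact (le_sup_left : f.fieldRange ≤ f.fieldRange ⊔ IntermediateField.adjoin K {ζ}) ⟨x, rfl⟩
    · exact (le_sup_right : IntermediateField.adjoin K {ζ} ≤ f.fieldRange ⊔ _)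
        (IntermediateField.mem_adjoin_simple_self K ζ)
  have hn : Normal K (f.fieldRange ⊔ IntermediateField.adjoin K {ζ} : IntermediateField K L') :=
    inferInstance
  rw [htop] at hn
  have : Normal K L' := Normal.of_algEquiv IntermediateField.topEquiv
  exact ⟨⟩

/-- Restriction of automorphisms over `K(ζ)` of a cyclotomic extension of `L` to `L`. -/
noncomputable def cyclotomicRestrict [IsGalois K L] (ζ : L') :
    Gal(L'/IntermediateField.adjoin K {ζ}) →* Gal(L/K) :=
  (AlgEquiv.restrictNormalHom L).comp
    (AlgEquiv.restrictScalarsHom (R := K) (S := IntermediateField.adjoin K {ζ}) (A := L'))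

theorem cyclotomicRestrict_apply [IsGalois K L] (ζ : L') (σ : Gal(L'/IntermediateField.adjoin K {ζ}))
    (x : L) : algebraMap L L' (cyclotomicRestrict ζ σ x) = σ (algebraMap L L' x) :=
  AlgEquiv.restrictNormal_commutes (σ.restrictScalars K) L x

theorem cyclotomicRestrict_injective [IsGalois K L] (hζ : IsPrimitiveRoot ζ p) :
    Function.Injective (cyclotomicRestrict (K := K) (L := L) ζ) := by
  intro σ τ h
  apply AlgEquiv.restrictScalars_injective K
  refine algEquiv_ext_of_eq (L := L) hζ (fun x => ?_) ?_
  · change σ _ = τ _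
    rw [← cyclotomicRestrict_apply, h, cyclotomicRestrict_apply]
  · have hm : ζ ∈ IntermediateField.adjoin K {ζ} := IntermediateField.mem_adjoin_simple_self K ζ
    exact (σ.commutes ⟨ζ, hm⟩).trans (τ.commutes ⟨ζ, hm⟩).symm

theorem isAbelianGalois_of_cyclotomic [FiniteDimensional K L] [IsAbelianGalois K L]
    (hζ : IsPrimitiveRoot ζ p) : IsAbelianGalois (IntermediateField.adjoin K {ζ}) L' := by
  have := isGalois_of_cyclotomic (K := K) (L := L) hζ
  have : IsGalois (IntermediateField.adjoin K {ζ}) L' := inferInstance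
  exact { is_comm := ⟨fun σ τ => cyclotomicRestrict_injective (L := L) hζ (by
    rw [map_mul, map_mul, gal_comm])⟩ }

/-- Automorphisms over `K(ζ)` commute with automorphisms over `L`. -/
theorem cyclotomic_commute [FiniteDimensional K L] [IsGalois K L] (hζ : IsPrimitiveRoot ζ p)
    (σ : Gal(L'/IntermediateField.adjoin K {ζ})) (τ : Gal(L'/L)) (x : L') :
    σ (τ x) = τ (σ x) := by
  have : NeZero p := ⟨(Fact.out : p.Prime).ne_zero⟩
  have hm : ζ ∈ IntermediateField.adjoin K {ζ} := IntermediateField.mem_adjoin_simple_self K ζ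
  have hσ : σ ζ = ζ := σ.commutes ⟨ζ, hm⟩
  obtain ⟨i, -, hi⟩ := hζ.eq_pow_of_pow_eq_one (ξ := τ ζ) (by
    rw [← map_pow, hζ.pow_eq_one, map_one])
  have := algEquiv_ext_of_eq (L := L) (K := K) hζ
    (σ := σ.restrictScalars K * τ.restrictScalars K)
    (τ := τ.restrictScalars K * σ.restrictScalars K)
    (fun y => by
      change σ (τ _) = τ (σ _)
      rw [τ.commutes, ← cyclotomicRestrict_apply, τ.commutes])
    (by
      change σ (τ _) = τ (σ _)
      rw [hσ, ← hi, map_pow, hσ])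
  exact DFunLike.congr_fun this x

end Cyclotomic

/-! ### Values, traces and normality over `K(ζ)`. -/

section CyclotomicValuation

variable {K L L' Γ₀ : Type*} [Field K] [Field L] [Field L'] [Algebra L L'] [Algebra K L']
  [Algebra K L] [IsScalarTower K L L'] [LinearOrderedCommGroupWithZero Γ₀] {u : Valuation L' Γ₀}
  {p : ℕ} [Fact p.Prime] {ζ : L'}

theorem isGalois_adjoin_primitiveRoot [Algebra.IsIntegral K L'] (hζ : IsPrimitiveRoot ζ p) :
    IsGalois K (IntermediateField.adjoin K {ζ}) := by
  have : NeZero p := ⟨(Fact.out : p.Prime).ne_zero⟩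
  have : IsCyclotomicExtension {p} K (IntermediateField.adjoin K {ζ}) :=
    hζ.intermediateField_adjoin_isCyclotomicExtension K
  exact IsCyclotomicExtension.isGalois {p} K _

theorem val_pow_finrank_eq_norm (hu : ∀ x y : L', minpoly K x = minpoly K y → u x = u y)
    (F : IntermediateField K L') [FiniteDimensional K F] [IsGalois K F] (c : F) :
    u (algebraMap F L' c) ^ Module.finrank K F =
      u (algebraMap K L' (Algebra.norm K c)) := by
  rw [IsScalarTower.algebraMap_apply K F L', Algebra.norm_eq_prod_automorphisms, map_prod, map_prod,
    ← IsGalois.card_aut_eq_finrank, ← Fintype.card_eq_nat_card, ← Finset.card_univ,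
    eq_comm, Finset.prod_eq_pow_card]
  intro σ _
  refine hu _ _ ?_
  rw [minpoly.algebraMap_eq (algebraMap F L').injective,
    minpoly.algebraMap_eq (algebraMap F L').injective]
  exact minpoly.algEquiv_eq σ c

/-- Raising to the power `D = [K(ζ):K]` replaces scalars by their norms to `K`, so equal values give
`[L:K] ∣ (i - j) * D`; as `D` is prime to `p`, this forces `i = j`. -/
theorem isValuationIndependent_cyclotomic [FiniteDimensional K L] [FiniteDimensional L L']
    {w : Valuation L ℤᵐ⁰} (hw : Function.Surjective w) (hram : IsTotallyRamified K w)
    {k : ℕ} (hdeg : Module.finrank K L = p ^ k)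
    (hequiv : w.IsEquiv (u.comap (algebraMap L L')))
    (hu : ∀ x y : L', minpoly K x = minpoly K y → u x = u y) (hζ : IsPrimitiveRoot ζ p)
    {π : L} (hπ0 : π ≠ 0) (hπ : normOrd w π = 1) :
    IsValuationIndependent (IntermediateField.adjoin K {ζ}) u
      fun i : Fin (Module.finrank K L) => algebraMap L L' π ^ (i : ℕ) := by
  have : FiniteDimensional K L' := FiniteDimensional.trans K L L'
  have : IsGalois K (IntermediateField.adjoin K {ζ}) := isGalois_adjoin_primitiveRoot hζ
  set D := Module.finrank K (IntermediateField.adjoin K {ζ}) with hD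
  have hval : ∀ (a : IntermediateField.adjoin K {ζ}) (i : ℕ), u (a • algebraMap L L' π ^ i) ^ D =
      u.comap (algebraMap L L') (algebraMap K L (Algebra.norm K a) * π ^ (i * D)) := by
    intro a i
    rw [Algebra.smul_def, map_mul, mul_pow, hD, val_pow_finrank_eq_norm hu, ← hD,
      Valuation.comap_apply, map_mul, map_mul, ← IsScalarTower.algebraMap_apply, map_pow, map_pow,
      map_pow, pow_mul]
  intro i j a c ha hc h
  replace h := congrArg (· ^ D) h
  simp only [hval] at h
  rw [← hequiv.eq_iff] at h
  have ha0 : Algebra.norm K a ≠ 0 := Algebra.norm_ne_zero_iff.2 ha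
  have hc0 : Algebra.norm K c ≠ 0 := Algebra.norm_ne_zero_iff.2 hc
  have ha' : algebraMap K L (Algebra.norm K a) ≠ 0 := by simpa using ha0
  have hc' : algebraMap K L (Algebra.norm K c) ≠ 0 := by simpa using hc0
  have hi := pow_ne_zero ((i : ℕ) * D) hπ0
  have hj := pow_ne_zero ((j : ℕ) * D) hπ0
  rw [val_eq_iff hw (mul_ne_zero ha' hi) (mul_ne_zero hc' hj), normOrd_mul hw ha' hi,
    normOrd_mul hw hc' hj, normOrd_pow hw hπ0, normOrd_pow hw hπ0, hπ] at h
  have h1 := (exists_normOrd_algebraMap_iff hw hram).1 ⟨_, ha0, rfl⟩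
  have h2 := (exists_normOrd_algebraMap_iff hw hram).1 ⟨_, hc0, rfl⟩
  have h3 : (Module.finrank K L : ℤ) ∣ ((i : ℤ) - j) * D := by
    have := dvd_sub h2 h1
    push_cast at h
    rwa [show ((i : ℤ) - j) * D = normOrd w (algebraMap K L (Algebra.norm K c)) -
      normOrd w (algebraMap K L (Algebra.norm K a)) by linarith]
  have hcop : IsCoprime (Module.finrank K L : ℤ) (D : ℤ) := by
    rw [hdeg]
    exact Nat.isCoprime_iff_coprime.2 ((finrank_adjoin_primitiveRoot_coprime hζ).pow_right k).symm
  have := Int.eq_zero_of_abs_lt_dvd (hcop.dvd_of_dvd_mul_right h3)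
    (by rw [abs_lt]; constructor <;> omega)
  ext
  omega

/-- Independence of the powers of `π` over `K(ζ)` gives one inequality, restriction of automorphisms
to `L` the other. -/
theorem finrank_cyclotomic_eq [IsCyclotomicExtension {p} L L'] [FiniteDimensional K L]
    [FiniteDimensional L L'] [IsGalois K L] (hζ : IsPrimitiveRoot ζ p) {π : L} (hπ0 : π ≠ 0)
    (hind : IsValuationIndependent (IntermediateField.adjoin K {ζ}) u
      fun i : Fin (Module.finrank K L) => algebraMap L L' π ^ (i : ℕ)) :
    Module.finrank K L = Module.finrank (IntermediateField.adjoin K {ζ}) L' := by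
  have : FiniteDimensional K L' := FiniteDimensional.trans K L L'
  have := isGalois_of_cyclotomic (K := K) (L := L) hζ
  refine le_antisymm ?_ ?_
  · simpa using (hind.linearIndependent fun i => pow_ne_zero _ (by simpa using hπ0)
      ).fintype_card_le_finrank
  · rw [← IsGalois.card_aut_eq_finrank, ← IsGalois.card_aut_eq_finrank]
    exact Nat.card_le_card_of_injective _ (cyclotomicRestrict_injective (L := L) hζ)

theorem cyclotomicRestrict_bijective [IsCyclotomicExtension {p} L L'] [FiniteDimensional K L]
    [FiniteDimensional L L'] [IsGalois K L] (hζ : IsPrimitiveRoot ζ p)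
    (hfin : Module.finrank K L = Module.finrank (IntermediateField.adjoin K {ζ}) L') :
    Function.Bijective (cyclotomicRestrict (K := K) (L := L) ζ) := by
  have : FiniteDimensional K L' := FiniteDimensional.trans K L L'
  have := isGalois_of_cyclotomic (K := K) (L := L) hζ
  rw [Nat.bijective_iff_injective_and_card]
  exact ⟨cyclotomicRestrict_injective (L := L) hζ, by
    rw [IsGalois.card_aut_eq_finrank, IsGalois.card_aut_eq_finrank, hfin]⟩

theorem trace_cyclotomic [IsCyclotomicExtension {p} L L'] [FiniteDimensional K L]
    [FiniteDimensional L L'] [IsGalois K L] (hζ : IsPrimitiveRoot ζ p)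
    (hfin : Module.finrank K L = Module.finrank (IntermediateField.adjoin K {ζ}) L') (x : L) :
    Algebra.trace (IntermediateField.adjoin K {ζ}) L' (algebraMap L L' x) =
      algebraMap K (IntermediateField.adjoin K {ζ}) (Algebra.trace K L x) := by
  have : FiniteDimensional K L' := FiniteDimensional.trans K L L'
  have := isGalois_of_cyclotomic (K := K) (L := L) hζ
  apply (algebraMap (IntermediateField.adjoin K {ζ}) L').injective
  rw [trace_eq_sum_automorphisms, ← IsScalarTower.algebraMap_apply,
    IsScalarTower.algebraMap_apply K L L', trace_eq_sum_automorphisms, map_sum]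
  refine Fintype.sum_bijective _ (cyclotomicRestrict_bijective hζ hfin) _ _ fun σ => ?_
  rw [cyclotomicRestrict_apply]

/-- An element in the critical class keeps its non-degeneracy for the trace after adjoining `ζ`. -/
theorem trace_cyclotomic_ne_zero [IsCyclotomicExtension {p} L L'] [FiniteDimensional K L]
    [FiniteDimensional L L'] [IsGalois K L] {v : Valuation K ℤᵐ⁰} {w : Valuation L ℤᵐ⁰}
    [v.HasExtension w] (hw : Function.Surjective w) (hram : IsTotallyRamified K w)
    (hequiv : w.IsEquiv (u.comap (algebraMap L L'))) (hζ : IsPrimitiveRoot ζ p)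
    {π : L} (hπ0 : π ≠ 0) (hπ : normOrd w π = 1)
    (hind : IsValuationIndependent (IntermediateField.adjoin K {ζ}) u
      fun i : Fin (Module.finrank K L) => algebraMap L L' π ^ (i : ℕ))
    {x : L} (hx0 : x ≠ 0)
    (hx : normOrd w x ≡ -differentValuation v w - 1 [ZMOD (Module.finrank K L : ℤ)])
    {y : L'} (hy0 : y ≠ 0) (hy : u y = 1) :
    Algebra.trace (IntermediateField.adjoin K {ζ}) L' (algebraMap L L' x * y) ≠ 0 := by
  have : FiniteDimensional K L' := FiniteDimensional.trans K L L'
  have hfin := finrank_cyclotomic_eq hζ hπ0 hind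
  have hπL : algebraMap L L' π ≠ 0 := by simpa using hπ0
  set b := powBasis hfin hπL hind with hb
  have hbi : IsValuationIndependent (IntermediateField.adjoin K {ζ}) u b := by
    rw [hb, coe_powBasis]; exact hind
  have hbπ : ∀ i, b i = algebraMap L L' π ^ (i : ℕ) := fun i => by rw [hb, coe_powBasis]
  obtain ⟨hTx, hle⟩ := val_trace_mul_pow_le v hw hram hx0 hx
  obtain ⟨i, hi, hdom, hyi⟩ := hbi.exists_dominant hy0
  have hi0 : (i : ℕ) = 0 := by
    let i₀ : Fin (Module.finrank K L) := ⟨0, Module.finrank_pos⟩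
    have := hbi i i₀ (b.repr y i) 1 hi one_ne_zero (by
      rw [← hyi, hy, hbπ]; simp [i₀])
    rw [this]
  set T := Algebra.trace K L with hT
  have hterm : ∀ j, b.repr y j • Algebra.trace (IntermediateField.adjoin K {ζ}) L'
      (algebraMap L L' x * b j) = b.repr y j *
        algebraMap K (IntermediateField.adjoin K {ζ}) (T (x * π ^ (j : ℕ))) := by
    intro j
    rw [hbπ, ← map_pow, ← map_mul, trace_cyclotomic hζ hfin, smul_eq_mul]
  have hsum : Algebra.trace (IntermediateField.adjoin K {ζ}) L' (algebraMap L L' x * y) =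
      ∑ j, b.repr y j *
        algebraMap K (IntermediateField.adjoin K {ζ}) (T (x * π ^ (j : ℕ))) := by
    conv_lhs => rw [← b.sum_repr y, Finset.mul_sum, map_sum]
    refine Finset.sum_congr rfl fun j _ => ?_
    rw [mul_smul_comm, map_smul, hterm]
  set A := algebraMap (IntermediateField.adjoin K {ζ}) L' with hA
  have hcomp : ∀ t : K, A (algebraMap K (IntermediateField.adjoin K {ζ}) t) =
      algebraMap L L' (algebraMap K L t) := fun t => by
    rw [hA, ← IsScalarTower.algebraMap_apply, ← IsScalarTower.algebraMap_apply]
  have hTx' : algebraMap L L' (algebraMap K L (T x)) ≠ 0 := by simpa using hTx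
  -- The constant coordinate of `y` dominates, and the bound on the traces of `x * π ^ j` carries
  -- this dominance over to the trace of `x * y`.
  have hdomT : ∀ j, j ≠ i → u (A (b.repr y j *
      algebraMap K (IntermediateField.adjoin K {ζ}) (T (x * π ^ (j : ℕ))))) <
      u (A (b.repr y i * algebraMap K (IntermediateField.adjoin K {ζ}) (T (x * π ^ (i : ℕ))))) := by
    intro j hj
    rw [map_mul A, map_mul u, map_mul A, map_mul u, hcomp, hcomp, hi0, pow_zero, mul_one]
    have h1 := hle π hπ0 hπ j j.2
    rw [← map_mul, hequiv, Valuation.comap_apply, Valuation.comap_apply,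
      map_mul (algebraMap L L') (algebraMap K L (T x)), map_mul u] at h1
    have h2 := hdom j hj
    rw [Algebra.smul_def, Algebra.smul_def, hbπ, hbπ, hi0, pow_zero, mul_one, map_mul] at h2
    calc _ ≤ u (A (b.repr y j)) * (u (algebraMap L L' (algebraMap K L (T x))) *
          u (algebraMap L L' (π ^ (j : ℕ)))) := mul_le_mul_right h1 _
      _ = (u (A (b.repr y j)) * u (algebraMap L L' π ^ (j : ℕ))) *
          u (algebraMap L L' (algebraMap K L (T x))) := by rw [map_pow (algebraMap L L')]; ac_rfl
      _ < _ := mul_lt_mul_of_pos_right h2 (zero_lt_iff.2 ((u.ne_zero_iff).2 hTx'))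
  intro h0
  have h := u.map_sum_eq_of_lt (s := Finset.univ) (Finset.mem_univ i)
    (fun j hj => hdomT j (by simpa using hj))
  rw [← map_sum, ← hsum, h0, map_zero, map_zero, hi0, pow_zero, mul_one, map_mul A, map_mul u,
    hcomp, eq_comm, mul_eq_zero, map_eq_zero u, map_eq_zero u] at h
  rcases h with h | h
  · exact hi (by simpa [hA] using h)
  · exact hTx' h

/-- After adjoining a primitive `p`-th root of unity to a base field without one, every non-zero
stable subspace contains an element of value one. -/
theorem exists_val_eq_one_cyclotomic [IsCyclotomicExtension {p} L L'] [FiniteDimensional K L]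
    [FiniteDimensional L L'] [IsAbelianGalois K L] {k : ℕ} (hdeg : Module.finrank K L = p ^ k)
    (hp0 : (p : K) ≠ 0) (hno : ¬ ∃ ζ : K, IsPrimitiveRoot ζ p)
    (hu : ∀ x y : L', minpoly K x = minpoly K y → u x = u y) (hζ : IsPrimitiveRoot ζ p)
    {M : Submodule (IntermediateField.adjoin K {ζ}) L'}
    (hM : ∀ g : Gal(L'/IntermediateField.adjoin K {ζ}), ∀ x ∈ M, g x ∈ M) (hM0 : M ≠ ⊥) :
    ∃ y ∈ M, y ≠ 0 ∧ u y = 1 := by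
  have hp : p.Prime := Fact.out
  have : FiniteDimensional K L' := FiniteDimensional.trans K L L'
  have := isAbelianGalois_of_cyclotomic (K := K) (L := L) hζ
  have hp2 : p ≠ 2 := by
    rintro rfl
    refine hno ⟨-1, ?_⟩
    have : orderOf (-1 : K) = 2 := orderOf_eq_prime (by norm_num) (fun h => hp0 (by
      have : (2 : K) = 1 - (-1) := by norm_num
      push_cast
      rw [this, h, sub_self]))
    exact this ▸ IsPrimitiveRoot.orderOf (-1 : K)
  have hpow : ∀ σ : Gal(L'/IntermediateField.adjoin K {ζ}), σ ^ p ^ k = 1 := by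
    intro σ
    apply cyclotomicRestrict_injective (L := L) hζ
    rw [map_pow, map_one, ← hdeg, ← IsGalois.card_aut_eq_finrank]
    exact pow_card_eq_one'
  obtain ⟨k', -, hexp⟩ := (Nat.dvd_prime_pow hp).1
    (Monoid.exponent_dvd_of_forall_pow_eq_one hpow)
  have hζ' : IsPrimitiveRoot (IntermediateField.AdjoinSimple.gen K ζ) p :=
    IsPrimitiveRoot.of_map_of_injective
      (f := algebraMap (IntermediateField.adjoin K {ζ}) L') hζ
      (algebraMap (IntermediateField.adjoin K {ζ}) L').injective
  obtain ⟨α, hα0, hline, -⟩ := exists_fixedFieldLine_le hexp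
    (fun ξ => X_pow_sub_C_splits_of_isPrimitiveRoot hζ' rfl) (fun h => absurd h hp2) hM hM0
  set S := scalarStabilizer (IntermediateField.adjoin K {ζ}) α with hS
  have hroot : ∀ {h : Gal(L'/IntermediateField.adjoin K {ζ})} {c : IntermediateField.adjoin K {ζ}},
      h α = algebraMap _ L' c * α → algebraMap _ L' c ^ p ^ k = 1 := by
    intro h c hc
    have h1 := pow_apply_of_apply_eq hc (p ^ k)
    rw [hpow, AlgEquiv.one_apply] at h1
    rw [← map_pow]
    exact (mul_right_cancel₀ hα0 ((one_mul α).trans h1)).symm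
  have hunit : ∀ c : L, c ^ p ^ k = 1 → c = 1 := by
    intro c hc
    by_contra hc1
    have hnot := not_isPrimitiveRoot_of_finrank_eq_pow (K := K) (L := L) hdeg hno
    obtain ⟨l, -, hl⟩ := (Nat.dvd_prime_pow hp).1 (orderOf_dvd_of_pow_eq_one hc)
    match l, hl with
    | 0, hl => exact hc1 (orderOf_eq_one_iff.1 (by simpa using hl))
    | l + 1, hl =>
      have := IsPrimitiveRoot.orderOf c
      rw [hl] at this
      exact hnot _ (this.pow (pow_pos hp.pos _) (pow_succ p l))
  have hGal : IsGalois L L' := IsCyclotomicExtension.isGalois {p} L L'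
  -- Scalars of `S` are `p`-power roots of unity, and so are their norms to `L`. These are `1`, as
  -- `L` has no others: its degree over `K` is a power of `p`.
  have hβ : algebraMap L L' (Algebra.norm L α) ∈ IntermediateField.fixedField S := by
    rw [mem_fixedField]
    rintro h ⟨c, hc⟩
    rw [Algebra.norm_eq_prod_automorphisms, map_prod]
    have h1 : ∀ τ : Gal(L'/L), h (τ α) = τ (algebraMap _ L' c) * τ α := fun τ => by
      rw [cyclotomic_commute (K := K) hζ, hc, map_mul]
    simp only [h1]
    have hN : Algebra.norm L (algebraMap _ L' c) = 1 :=
      hunit _ (by rw [← map_pow, hroot hc, map_one])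
    rw [Finset.prod_mul_distrib, ← Algebra.norm_eq_prod_automorphisms, hN, map_one, one_mul]
  have hβu : u (algebraMap L L' (Algebra.norm L α)) = u α ^ Module.finrank L L' := by
    rw [Algebra.norm_eq_prod_automorphisms, map_prod, ← IsGalois.card_aut_eq_finrank,
      ← Fintype.card_eq_nat_card, ← Finset.card_univ, Finset.prod_eq_pow_card]
    intro τ _
    exact hu _ _ (minpoly.algEquiv_eq (τ.restrictScalars K) α)
  have hαp : α ^ p ^ k ∈ IntermediateField.fixedField S := by
    rw [mem_fixedField]
    rintro h ⟨c, hc⟩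
    rw [map_pow, hc, mul_pow, hroot hc, one_mul]
  have hcop : IsCoprime (Module.finrank L L' : ℤ) ((p ^ k : ℕ) : ℤ) :=
    Nat.isCoprime_iff_coprime.2 ((finrank_cyclotomic_coprime hζ).pow_right k)
  obtain ⟨a, b, hab⟩ := hcop
  have hu0 : u α ≠ 0 := (u.ne_zero_iff).2 hα0
  have hβ0 : algebraMap L L' (Algebra.norm L α) ≠ 0 := by
    simpa using hα0
  -- The norm has value `u α ^ [L':L]` and `α ^ p ^ k` has value `u α ^ p ^ k`; Bézout for the
  -- coprime exponents yields an element of the fixed field with the value of `α`.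
  set e := algebraMap L L' (Algebra.norm L α) ^ a * (α ^ p ^ k) ^ b with he
  have he0 : e ≠ 0 := mul_ne_zero (zpow_ne_zero _ hβ0) (zpow_ne_zero _ (pow_ne_zero _ hα0))
  have heu : u e = u α := by
    rw [he, map_mul, map_zpow₀, map_zpow₀, hβu, map_pow, ← zpow_natCast, ← zpow_mul,
      ← zpow_natCast, ← zpow_mul, ← zpow_add₀ hu0, mul_comm _ a, mul_comm _ b, hab, zpow_one]
  refine ⟨e⁻¹ * α, hline (mem_fixedFieldLine.2
    ⟨e⁻¹, inv_mem (mul_mem (zpow_mem hβ a) (zpow_mem hαp b)), rfl⟩),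
    mul_ne_zero (inv_ne_zero he0) hα0, ?_⟩
  rw [map_mul, map_inv₀, heu, inv_mul_cancel₀ hu0]

/-- Normality over `K(ζ)` descends to `K`. -/
theorem IsNormalElement.of_cyclotomic [IsCyclotomicExtension {p} L L'] [FiniteDimensional K L]
    [FiniteDimensional L L'] [IsGalois K L] (hζ : IsPrimitiveRoot ζ p)
    (hfin : Module.finrank K L = Module.finrank (IntermediateField.adjoin K {ζ}) L') {x : L}
    (hx : IsNormalElement (IntermediateField.adjoin K {ζ}) (algebraMap L L' x)) :
    IsNormalElement K x := by
  have : Fintype Gal(L/K) := Fintype.ofFinite _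
  let e := Equiv.ofBijective _ (cyclotomicRestrict_bijective (K := K) (L := L) hζ hfin)
  have h1 : LinearIndependent K (fun σ : Gal(L/K) => algebraMap L L' (σ x)) := by
    have h2 := (hx.1.restrict_scalars' K).comp e.symm e.symm.injective
    convert h2 using 1
    ext σ
    simp only [Function.comp_apply]
    rw [← cyclotomicRestrict_apply]
    exact congrArg (fun τ : Gal(L/K) => algebraMap L L' (τ x)) (e.apply_symm_apply σ).symm
  have h3 : LinearIndependent K (fun σ : Gal(L/K) => σ x) :=
    LinearIndependent.of_comp (IsScalarTower.toAlgHom K L L').toLinearMap h1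
  refine ⟨h3, h3.span_eq_top_of_card_eq_finrank' ?_⟩
  rw [← Nat.card_eq_fintype_card, IsGalois.card_aut_eq_finrank]

end CyclotomicValuation

/-! ### The two sufficient conditions and the final assembly. -/

section Main

variable {K L : Type*} [Field K] [Field L] [Algebra K L] [Valued K ℤᵐ⁰]

theorem valuationCriterion_of_no_primitiveRoot [CompleteSpace K]
    (hv : Function.Surjective (Valued.v : Valuation K ℤᵐ⁰))
    {w : Valuation L ℤᵐ⁰} (hw : Function.Surjective w)
    [(Valued.v : Valuation K ℤᵐ⁰).HasExtension w] {p k : ℕ} [Fact p.Prime]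
    [FiniteDimensional K L] [IsAbelianGalois K L] (hram : IsTotallyRamified K w)
    (hdeg : Module.finrank K L = p ^ k) (hp0 : (p : K) ≠ 0)
    (hno : ¬ ∃ ζ : K, IsPrimitiveRoot ζ p) :
    ValuationCriterion (Valued.v : Valuation K ℤᵐ⁰) w := by
  intro x hx0 hx
  rw [show ramificationIndex K w = Module.finrank K L from hram] at hx
  have hp : p.Prime := Fact.out
  have : NeZero p := ⟨hp.ne_zero⟩
  have : NeZero (p : L) := ⟨fun h => hp0 <| (algebraMap K L).injective <| by
    rw [map_natCast, map_zero, h]⟩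
  have : FiniteDimensional L (CyclotomicField p L) :=
    IsCyclotomicExtension.finiteDimensional {p} L _
  have : FiniteDimensional K (CyclotomicField p L) := FiniteDimensional.trans K L _
  obtain ⟨ζ, hζ⟩ := IsCyclotomicExtension.exists_isPrimitiveRoot (S := {p}) L (CyclotomicField p L)
    (Set.mem_singleton p) hp.ne_zero
  obtain ⟨u, hu1, hu2⟩ := exists_spectral_valuation hv (CyclotomicField p L)
  have hequiv : w.IsEquiv (u.comap (algebraMap L (CyclotomicField p L))) := by
    refine isEquiv_of_isTotallyRamified (K := K) hw hram fun c => ?_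
    rw [Valuation.comap_apply, ← IsScalarTower.algebraMap_apply, hu1,
      Valuation.HasExtension.val_map_le_one_iff (Valued.v : Valuation K ℤᵐ⁰) w]
  obtain ⟨π, hπ0, hπ⟩ := exists_uniformizer hw
  have hind := isValuationIndependent_cyclotomic hw hram hdeg hequiv hu2 hζ hπ0 hπ
  have := isAbelianGalois_of_cyclotomic (K := K) (L := L) hζ
  refine IsNormalElement.of_cyclotomic hζ (finrank_cyclotomic_eq hζ hπ0 hind) ?_
  exact isNormalElement_of_trace_ne_zero (fun y => u y = 1)
    (fun y hy0 hy => trace_cyclotomic_ne_zero hw hram hequiv hζ hπ0 hπ hind hx0 hx hy0 hy)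
    (fun M hM hM0 => exists_val_eq_one_cyclotomic hdeg hp0 hno hu2 hζ hM hM0)

theorem valuationCriterion_of_isUnitRootKummer
    {w : Valuation L ℤᵐ⁰} (hw : Function.Surjective w)
    [(Valued.v : Valuation K ℤᵐ⁰).HasExtension w] {p k : ℕ} [Fact p.Prime]
    [FiniteDimensional K L] [IsAbelianGalois K L] (hram : IsTotallyRamified K w)
    (hexp : Monoid.exponent Gal(L/K) = p ^ k)
    (hsplit : ∀ ξ : K, (X ^ p - C (ξ ^ p)).Splits)
    (h2 : p = 2 → 8 ∣ p ^ k → Nat.card (rootsOfUnity (p ^ k) K) ≠ 2)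
    (hK : ∀ (E : IntermediateField K L) (F : IntermediateField E L),
      IsGalois E F → IsCyclic Gal(F/E) → Module.finrank E F = Nat.card (rootsOfUnity (p ^ k) K) →
        IsUnitRootKummer (w.comap (algebraMap E L)) F) :
    ValuationCriterion (Valued.v : Valuation K ℤᵐ⁰) w := by
  intro x hx0 hx
  rw [show ramificationIndex K w = Module.finrank K L from hram] at hx
  refine isNormalElement_of_trace_ne_zero (fun y => w y = 1) (fun y hy0 hy => ?_)
    (fun M hM hM0 => exists_val_eq_one_of_isUnitRootKummer hexp hsplit h2 hK hM hM0)
  refine (val_trace_mul_pow_le (Valued.v : Valuation K ℤᵐ⁰) hw hram (mul_ne_zero hx0 hy0) ?_).1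
  rwa [normOrd_mul hw hx0 hy0, (normOrd_eq_iff hw hy0 (n := 0)).2 (by simpa using hy), add_zero]

end Main

theorem splits_X_pow_sub_C_pow_of_charP {K : Type*} [Field K] (p : ℕ) [Fact p.Prime] [CharP K p]
    (ξ : K) : (X ^ p - C (ξ ^ p)).Splits := by
  rw [C_pow, ← sub_pow_char]
  exact (Splits.X_sub_C ξ).pow p

theorem card_rootsOfUnity_eq_one_of_no_primitiveRoot {K : Type*} [Field K] {p : ℕ} [Fact p.Prime]
    (k : ℕ) (hno : ¬ ∃ ζ : K, IsPrimitiveRoot ζ p) : Nat.card (rootsOfUnity (p ^ k) K) = 1 := by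
  have hp : p.Prime := Fact.out
  have : NeZero (p ^ k) := ⟨pow_ne_zero _ hp.ne_zero⟩
  obtain ⟨l, -, hl⟩ := (Nat.dvd_prime_pow hp).1 (card_rootsOfUnity_dvd K (p ^ k))
  obtain ⟨ζ, hζ⟩ := exists_isPrimitiveRoot_card K (p ^ k)
  rw [hl] at hζ ⊢
  match l, hζ with
  | 0, _ => exact pow_zero p
  | l + 1, hζ => exact absurd ⟨_, hζ.pow (pow_pos hp.pos _) (pow_succ p l)⟩ hno

theorem isUnitRootKummer_of_finrank_eq_one {E : Type*} [Field E] (u : Valuation E ℤᵐ⁰)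
    (F : Type*) [Field F] [Algebra E F] [IsGalois E F] (h : Module.finrank E F = 1) :
    IsUnitRootKummer u F := by
  have hfin : FiniteDimensional E F := Module.finite_of_finrank_eq_succ h
  have hcard : Nat.card Gal(F/E) = 1 := by rw [IsGalois.card_aut_eq_finrank, h]
  have : Subsingleton Gal(F/E) := (Nat.card_eq_one_iff_unique.1 hcard).1
  exact ⟨hfin, .of_isCyclic E F, 1, ⟨1, IsPrimitiveRoot.one⟩, Monoid.exp_eq_one_iff.2 this,
    fun a _ _ => by simp⟩

theorem theorem2 {K L : Type*} [Field K] [Field L] [Algebra K L]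
    -- `K` is complete for a normalized discrete valuation
    [Valued K ℤᵐ⁰] [CompleteSpace K]
    (hv : Function.Surjective (Valued.v : Valuation K ℤᵐ⁰))
    -- `w` is the normalized valuation of `L`, extending that of `K` (up to equivalence)
    (w : Valuation L ℤᵐ⁰) (hw : Function.Surjective w)
    [(Valued.v : Valuation K ℤᵐ⁰).HasExtension w]
    -- the residue characteristic
    (p : ℕ) [Fact p.Prime]
    [CharP (IsLocalRing.ResidueField (Valued.v : Valuation K ℤᵐ⁰).integer) p]
    -- `L/K` is totally ramified, abelian, of `p`-power degree
    [FiniteDimensional K L] [IsAbelianGalois K L]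
    (hram : IsTotallyRamified K w)
    (hdeg : ∃ k : ℕ, Module.finrank K L = p ^ k)
    (m : ℕ) (hm : m = Monoid.exponent Gal(L/K))
    (r : ℕ) (hr : r = Nat.card (rootsOfUnity m K)) :
    ((p = 2 → 8 ∣ m → r ≠ 2) →
      (ValuationCriterion (Valued.v : Valuation K ℤᵐ⁰) w ↔
        ∀ (E : IntermediateField K L) (F : IntermediateField E L),
          IsGalois E F → IsCyclic Gal(F/E) → Module.finrank E F = r →
            IsUnitRootKummer (w.comap (algebraMap E L)) F)) ∧
    ((¬ ∃ ζ : K, IsPrimitiveRoot ζ p) →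
      ValuationCriterion (Valued.v : Valuation K ℤᵐ⁰) w) := by
  have hp : p.Prime := Fact.out
  obtain ⟨k, hdeg⟩ := hdeg
  obtain ⟨l, -, hl⟩ := (Nat.dvd_prime_pow hp).1
    (show Monoid.exponent Gal(L/K) ∣ p ^ k by
      rw [← hdeg, ← IsGalois.card_aut_eq_finrank]; exact Group.exponent_dvd_nat_card)
  rw [hl] at hm
  subst hm hr
  have : NeZero (p ^ l) := ⟨pow_ne_zero _ hp.ne_zero⟩
  have hback : (p = 2 → 8 ∣ p ^ l → Nat.card (rootsOfUnity (p ^ l) K) ≠ 2) →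
      (∀ (E : IntermediateField K L) (F : IntermediateField E L),
        IsGalois E F → IsCyclic Gal(F/E) →
          Module.finrank E F = Nat.card (rootsOfUnity (p ^ l) K) →
            IsUnitRootKummer (w.comap (algebraMap E L)) F) →
      ValuationCriterion (Valued.v : Valuation K ℤᵐ⁰) w := by
    intro h2 hK
    -- In characteristic `p` the binomial is `(X - ξ) ^ p`; a primitive `p`-th root of unity also
    -- splits it. The remaining case passes to `L(ζ)`.
    by_cases hp0 : (p : K) = 0
    · have : CharP K p := (CharP.charP_iff_prime_eq_zero hp).2 hp0
      exact valuationCriterion_of_isUnitRootKummer hw hram hl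
        (splits_X_pow_sub_C_pow_of_charP p) h2 hK
    by_cases hζ : ∃ ζ : K, IsPrimitiveRoot ζ p
    · obtain ⟨ζ, hζ⟩ := hζ
      exact valuationCriterion_of_isUnitRootKummer hw hram hl
        (fun ξ => X_pow_sub_C_splits_of_isPrimitiveRoot hζ rfl) h2 hK
    · exact valuationCriterion_of_no_primitiveRoot hv hw hram hdeg hp0 hζ
  refine ⟨fun h2 => ⟨fun hVC E F _ _ hEF =>
    isUnitRootKummer_of_valuationCriterion hw hram hVC E F hEF, hback h2⟩, fun hno => ?_⟩
  -- With `r = 1` the condition at `2` holds and the extensions to be tested are trivial.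
  have hr1 := card_rootsOfUnity_eq_one_of_no_primitiveRoot l hno
  refine hback (fun _ _ => by omega) fun E F _ _ hEF => ?_
  exact isUnitRootKummer_of_finrank_eq_one _ F (hEF.trans hr1)
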